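/- Let $p,n\in\mathbb N$, $n\ge 1$. Consider pairs $\{S,\nu\}$, where $S=S(n)=\{s_{j-i}\}_{i,j=1}^n>0$ is a positive definite block Toeplitz matrix with blocks $s_k\in\mathbb C^{p\times p}$ and $\nu=\nu^*\in\mathbb C^{p\times p}$. For $1\le k\le n$ let $S(k)=\{s_{j-i}\}_{i,j=1}^k$, let $\Phi_1(k)$ be the $kp\times p$ block column all of whose $k$ blocks are $I_p$, and let $\Phi_2(k)$ be the $kp\times p$ block column whose $i$-th block is $\frac{s_0}{2}+s_{-1}+\dots+s_{1-i}+\mathrm i\nu$ $(1\le i\le k)$. Put $$t_k=\begin{bmatrix}0&\cdots&0&I_p\end{bmatrix}S(k)^{-1}\begin{bmatrix}0&\cdots&0&I_p\end{bmatrix}^*,\qquad \begin{bmatrix}X_k&Y_k\end{bmatrix}=\begin{bmatrix}0&\cdots&0&I_p\end{bmatrix}S(k)^{-1}\begin{bmatrix}\Phi_1(k)&\Phi_2(k)\end{bmatrix},$$ $$K=\frac1{\sqrt2}\begin{bmatrix}I_p&-I_p\\ I_p&I_p\end{bmatrix},\qquad j=\begin{bmatrix}I_p&0\\0&-I_p\end{bmatrix},$$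 and, for $0\le k<n$, define the Dirac coefficients $$C_k=2K^*\beta(k)^*\beta(k)K-j,\qquad \beta(k)=t_{k+1}^{-1/2}\begin{bmatrix}X_{k+1}&Y_{k+1}\end{bmatrix}.$$ Partition $C_k=\{c_{il}\}_{i,l=1}^2$ into $p\times p$ blocks. The Verblunsky-type coefficients of the pair $\{S,\nu\}$ are $$\rho_k=c_{11}^{-1}c_{12}=\left(\begin{bmatrix}I_p&0\end{bmatrix}C_k\begin{bmatrix}I_p\\0\end{bmatrix}\right)^{-1}\begin{bmatrix}I_p&0\end{bmatrix}C_k\begin{bmatrix}0\\I_p\end{bmatrix}\qquad(0\le k<n).$$ Theorem. For every such pair $\{S,\nu\}$ and every $0\le k<n$, the block $c_{11}$ of $C_k$ is invertible and $\|\rho_k\|<1$, where $\|\cdot\|$ is the operator norm with respect to the Euclidean norm on $\mathbb C^p$ (the largest singular value). Moreover, for each $n\ge1$, the map $\{S,\nu\}\mapsto(\rho_k)_{0\le k<n}$ is a bijection from the set of all pairs $\{S,\nu\}$ with $S>0$ an $n\times n$ block Toeplitz matrix with $p\times p$ blocks and $\nu=\nu^*\in\mathbb C^{p\times p}$ onto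 the set of all sequences $(\rho_k)_{0\le k<n}$ of $p\times p$ complex matrices with $\|\rho_k\|<1$ for all $k$. -/

import Mathlib

namespace BlockToeplitz

open Matrix
open scoped ComplexOrder

noncomputable section

/-- The `p × p` block of `S` in block position `(i, j)`. -/
def block {n p : ℕ} (S : Matrix (Fin n × Fin p) (Fin n × Fin p) ℂ) (i j : Fin n) :
    Matrix (Fin p) (Fin p) ℂ :=
  Matrix.of fun a b => S (i, a) (j, b)

/-- `S = {s_{j-i}}` for some family `s` of `p × p` blocks. -/
def IsBlockToeplitz {n p : ℕ} (S : Matrix (Fin n × Fin p) (Fin n × Fin p) ℂ) : Prop :=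
  ∃ s : ℤ → Matrix (Fin p) (Fin p) ℂ,
    ∀ i j : Fin n, block S i j = s (((j : ℕ) : ℤ) - ((i : ℕ) : ℤ))

/-- The leading principal part `S(k+1)` of `S = S(n)`, consisting of the first `k + 1` block rows
and block columns, for `0 ≤ k < n`. -/
def leading {n p : ℕ} (S : Matrix (Fin n × Fin p) (Fin n × Fin p) ℂ) (k : Fin n) :
    Matrix (Fin ((k : ℕ) + 1) × Fin p) (Fin ((k : ℕ) + 1) × Fin p) ℂ :=
  Matrix.of fun x y => S (Fin.castLE k.isLt x.1, x.2) (Fin.castLE k.isLt y.1, y.2)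

/-- The `p × (m+1)p` matrix `[0 … 0 I_p]`. -/
def lastBlockRow (m p : ℕ) : Matrix (Fin p) (Fin (m + 1) × Fin p) ℂ :=
  Matrix.of fun a x => if x.1 = Fin.last m ∧ x.2 = a then 1 else 0

/-- `t = [0 … 0 I_p] S⁻¹ [0 … 0 I_p]^*`. -/
def t {m p : ℕ} (S : Matrix (Fin (m + 1) × Fin p) (Fin (m + 1) × Fin p) ℂ) :
    Matrix (Fin p) (Fin p) ℂ :=
  lastBlockRow m p * S⁻¹ * (lastBlockRow m p)ᴴ

/-- `Φ₁`: the block column all of whose blocks are `I_p`. -/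
def Phi1 (m p : ℕ) : Matrix (Fin (m + 1) × Fin p) (Fin p) ℂ :=
  Matrix.of fun x b => (1 : Matrix (Fin p) (Fin p) ℂ) x.2 b

/-- `Φ₂`: the block column with blocks `s₀/2 + s_{-1} + ⋯ + s_{-i}` (`0 ≤ i ≤ m`), plus `i Φ₁ ν`.
For `S = {s_{j-i}}` the block in position `(l, 0)` is `s_{-l}`. -/
def Phi2 {m p : ℕ} (S : Matrix (Fin (m + 1) × Fin p) (Fin (m + 1) × Fin p) ℂ)
    (ν : Matrix (Fin p) (Fin p) ℂ) : Matrix (Fin (m + 1) × Fin p) (Fin p) ℂ :=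
  (Matrix.of fun x b =>
      ((1 / 2 : ℂ) • block S 0 0 + ∑ l ∈ Finset.Ioc 0 x.1, block S l 0) x.2 b)
    + Complex.I • (Phi1 m p * ν)

/-- `[X Y] = [0 … 0 I_p] S⁻¹ [Φ₁ Φ₂]`. -/
def XY {m p : ℕ} (S : Matrix (Fin (m + 1) × Fin p) (Fin (m + 1) × Fin p) ℂ)
    (ν : Matrix (Fin p) (Fin p) ℂ) : Matrix (Fin p) (Fin p ⊕ Fin p) ℂ :=
  lastBlockRow m p * S⁻¹ * Matrix.fromCols (Phi1 m p) (Phi2 S ν)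

/-- `M^{-1/2}` for a positive definite matrix `M`, by the functional calculus. -/
def invSqrt {p : ℕ} (M : Matrix (Fin p) (Fin p) ℂ) : Matrix (Fin p) (Fin p) ℂ :=
  cfc (fun x : ℝ => (Real.sqrt x)⁻¹) M

/-- `β = t^{-1/2} [X Y]`. -/
def beta {m p : ℕ} (S : Matrix (Fin (m + 1) × Fin p) (Fin (m + 1) × Fin p) ℂ)
    (ν : Matrix (Fin p) (Fin p) ℂ) : Matrix (Fin p) (Fin p ⊕ Fin p) ℂ :=
  invSqrt (t S) * XY S ν

/-- `K = 2^{-1/2} [I_p, -I_p; I_p, I_p]`. -/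
def K (p : ℕ) : Matrix (Fin p ⊕ Fin p) (Fin p ⊕ Fin p) ℂ :=
  ((Real.sqrt 2 : ℝ) : ℂ)⁻¹ • Matrix.fromBlocks 1 (-1) 1 1

/-- `j = diag (I_p, -I_p)`. -/
def j (p : ℕ) : Matrix (Fin p ⊕ Fin p) (Fin p ⊕ Fin p) ℂ :=
  Matrix.fromBlocks 1 0 0 (-1)

/-- The Dirac coefficients `C_k = 2 K^* β(k)^* β(k) K - j`, where `β(k)` is formed from `S(k+1)`
and `ν`. -/
def diracCoeff {n p : ℕ} (S : Matrix (Fin n × Fin p) (Fin n × Fin p) ℂ)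
    (ν : Matrix (Fin p) (Fin p) ℂ) (k : Fin n) : Matrix (Fin p ⊕ Fin p) (Fin p ⊕ Fin p) ℂ :=
  (2 : ℂ) • ((K p)ᴴ * (beta (leading S k) ν)ᴴ * beta (leading S k) ν * K p) - j p

/-- The Verblunsky-type coefficients `ρ_k = c₁₁⁻¹ c₁₂`, where `C_k = {c_{ij}}`. -/
def verblunsky {n p : ℕ} (S : Matrix (Fin n × Fin p) (Fin n × Fin p) ℂ)
    (ν : Matrix (Fin p) (Fin p) ℂ) (k : Fin n) : Matrix (Fin p) (Fin p) ℂ :=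
  (diracCoeff S ν k).toBlocks₁₁⁻¹ * (diracCoeff S ν k).toBlocks₁₂

/-- The pairs `{S, ν}` of a positive definite block Toeplitz matrix `S` with `n × n` blocks of size
`p × p` and a self-adjoint `p × p` matrix `ν`. -/
def toeplitzPairs (n p : ℕ) :
    Set (Matrix (Fin n × Fin p) (Fin n × Fin p) ℂ × Matrix (Fin p) (Fin p) ℂ) :=
  {q | IsBlockToeplitz q.1 ∧ q.1.PosDef ∧ q.2.IsHermitian}

end

end BlockToeplitz

/- `S.PosDef` uses the order on `ℂ`; the norm of a matrix is the operator norm for the Euclidean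
norms (the largest singular value). -/
open scoped ComplexOrder Matrix.Norms.L2Operator

open scoped ComplexOrder Matrix.Norms.L2Operator

/-! Write `S` for `S(k+1)`, `e` for its last block row selector and `w = t⁻¹ e S⁻¹`, so that `w` has
last block `I` and `w S = t⁻¹ e`. Put `P = w (Φ₂ + Φ₁)` and `R = w (Φ₂ - Φ₁)`. The displacement
identity `L S + S L* = Φ₁ Φ₂* + Φ₂ Φ₁*`, with `L` as in `lowerHalf`, gives `P P* = R R* + 2 t⁻¹`.
Hence `P` is invertible and `r = P⁻¹ R` (`cayley`) is a strict contraction. Conjugation by `K` turns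
`C_k` into `[P R]* t [P R] - j`, so `c₁₁ = (1 - r r*)⁻¹ (1 + r r*)`, `c₁₂ = 2 (1 - r r*)⁻¹ r` and
`ρ_k = 2 (1 + r r*)⁻¹ r`. This last map is a bijection of the open unit ball, a matrix form of `tanh
x ↦ tanh 2x`. It remains to treat the contractions `r` in place of `ρ_k`.

For them the bijection is an induction on the size. For one block, `r` is the Cayley transform of
`s₀/2 + iν`, whose real and imaginary parts give back `s₀` and `ν`. When `S(m+1)` is fixed, `P` and
`R` of the next size are affine in the new block `s_{-(m+1)}`, with slopes `A` and `B` satisfying `B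
B* = A A* + 2 (S(m+1)⁻¹)₀₀`. Therefore `B - A r` is invertible for `‖r‖ < 1`, and `R = P r` has
exactly one solution `s_{-(m+1)}`. For this solution the Schur complement `q` satisfies `2 q = P (1
- r r*) P*`, so the extended matrix is positive definite once `P` is invertible, which is
`isUnit_plusPart_of_minusPart_eq`. -/

namespace BlockToeplitz

open Matrix
open scoped MatrixOrder

/-! ### Strict contractions and the doubling map on the open unit ball. -/

section Contractions

variable {m : Type*} [Fintype m] [DecidableEq m]

theorem norm_lt_one_iff_posDef (r : Matrix m m ℂ) : ‖r‖ < 1 ↔ (1 - r * rᴴ).PosDef := by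
  have hnonneg : 0 ≤ r * rᴴ := (posSemidef_self_mul_conjTranspose r).nonneg
  have hnorm : ‖r * rᴴ‖ = ‖r‖ * ‖r‖ := CStarRing.norm_self_mul_star (x := r)
  constructor
  · intro h
    have h1 : ‖r * rᴴ‖ < 1 := by
      rw [hnorm]; nlinarith [norm_nonneg r]
    have h2 : (1 - r * rᴴ).PosSemidef :=
      le_iff.1 ((CStarAlgebra.norm_le_one_iff_of_nonneg _ hnonneg).1 h1.le)
    exact h2.posDef_iff_isUnit.2 (isUnit_one_sub_of_norm_lt_one h1)
  · intro h
    have h1 : ‖r * rᴴ‖ ≤ 1 :=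
      (CStarAlgebra.norm_le_one_iff_of_nonneg _ hnonneg).2 (le_iff.2 h.posSemidef)
    have h2 : ‖r * rᴴ‖ ≠ 1 := by
      intro he
      -- The index type may be empty. Otherwise the norm of a nonnegative element lies in its
      -- spectrum, so norm 1 would make `1 - r * rᴴ` singular.
      rcases subsingleton_or_nontrivial (Matrix m m ℂ) with hs | hs
      · rw [Subsingleton.elim (r * rᴴ) 0, norm_zero] at he
        exact zero_ne_one he
      · have hmem := CStarAlgebra.norm_mem_spectrum_of_nonneg (a := r * rᴴ) hnonneg
        rw [he, spectrum.mem_iff, map_one] at hmem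
        exact hmem h.isUnit
    have h3 : ‖r * rᴴ‖ < 1 := lt_of_le_of_ne h1 h2
    rw [hnorm] at h3
    nlinarith [norm_nonneg r]

theorem isUnit_of_forall_mul_eq_zero {P : Matrix m m ℂ}
    (h : ∀ Z : Matrix m m ℂ, Z * P = 0 → Z = 0) : IsUnit P := by
  rw [isUnit_iff_isUnit_det, isUnit_iff_ne_zero]
  intro hdet
  obtain ⟨v, hv, hvP⟩ := exists_vecMul_eq_zero_iff.2 hdet
  apply hv
  have h0 := h (of fun _ => v) (by
    ext i k
    exact congrFun hvP k)
  ext i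
  exact congrFun (congrFun h0 i) i

theorem isUnit_of_mul_conjTranspose_eq {P R Q : Matrix m m ℂ} (hQ : Q.PosDef)
    (h : P * Pᴴ = R * Rᴴ + Q) : IsUnit P := by
  have h1 : IsUnit (P * Pᴴ) := by
    rw [h]; exact (hQ.posSemidef_add (posSemidef_self_mul_conjTranspose R)).isUnit
  rw [isUnit_iff_isUnit_det, det_mul] at h1
  exact (isUnit_iff_isUnit_det _).2 (isUnit_of_mul_isUnit_left h1)

theorem _root_.Matrix.PosDef.conjugate {Q U : Matrix m m ℂ} (hQ : Q.PosDef) (hU : IsUnit U) :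
    (U * Q * Uᴴ).PosDef :=
  (IsUnit.posDef_star_right_conjugate_iff hU).2 hQ

theorem norm_inv_mul_lt_one {P R Q : Matrix m m ℂ} (hQ : Q.PosDef)
    (h : P * Pᴴ = R * Rᴴ + Q) : ‖P⁻¹ * R‖ < 1 := by
  have hP := isUnit_of_mul_conjTranspose_eq hQ h
  have hdet : IsUnit P.det := (isUnit_iff_isUnit_det _).1 hP
  rw [norm_lt_one_iff_posDef]
  have h1 : (1 : Matrix m m ℂ) - P⁻¹ * R * (P⁻¹ * R)ᴴ = P⁻¹ * Q * (P⁻¹)ᴴ := by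
    have h2 : P⁻¹ * (P * Pᴴ) * (P⁻¹)ᴴ = 1 := by
      rw [nonsing_inv_mul_cancel_left _ _ hdet, ← conjTranspose_mul, nonsing_inv_mul _ hdet,
        conjTranspose_one]
    rw [← h2, h, conjTranspose_mul]
    noncomm_ring
  rw [h1]
  exact hQ.conjugate ((isUnit_nonsing_inv_iff).2 hP)

/-- Factor out `C`: what remains is `1 - C⁻¹ A r`, where `C⁻¹ A` and `r` are both strict
contractions. In the extension step this yields solvability and uniqueness. -/
theorem isUnit_sub_mul {C A Q r : Matrix m m ℂ} (hQ : Q.PosDef) (h : C * Cᴴ = A * Aᴴ + Q)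
    (hr : ‖r‖ < 1) : IsUnit (C - A * r) := by
  have hC := isUnit_of_mul_conjTranspose_eq hQ h
  have hdet : IsUnit C.det := (isUnit_iff_isUnit_det _).1 hC
  have h1 : ‖C⁻¹ * A * r‖ < 1 :=
    (norm_mul_le _ _).trans_lt
      (mul_lt_one_of_nonneg_of_lt_one_left (norm_nonneg _) (norm_inv_mul_lt_one hQ h) hr.le)
  have h2 : C - A * r = C * (1 - C⁻¹ * A * r) := by
    rw [mul_sub, mul_one, mul_assoc C⁻¹, mul_nonsing_inv_cancel_left _ _ hdet]
  rw [h2]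
  exact hC.mul (isUnit_one_sub_of_norm_lt_one h1)

/-- The map `r ↦ 2 (1 + r r*)⁻¹ r` on matrices. -/
noncomputable def doubling (r : Matrix m m ℂ) : Matrix m m ℂ :=
  (2 : ℂ) • ((1 + r * rᴴ)⁻¹ * r)

theorem posDef_one_add_mul_conjTranspose (r : Matrix m m ℂ) : (1 + r * rᴴ).PosDef :=
  PosDef.one.add_posSemidef (posSemidef_self_mul_conjTranspose r)

/-- With `B = (1 + r r*)⁻¹` one has `B r r* = 1 - B`, so the left side is `1 - 4 (1 - B) B = (2 B -
1)²`. Being a perfect square, it lets `r` be recovered by a positive square root. -/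
theorem one_sub_doubling (r : Matrix m m ℂ) :
    1 - doubling r * (doubling r)ᴴ = ((2 : ℂ) • (1 + r * rᴴ)⁻¹ - 1) * ((2 : ℂ) • (1 + r * rᴴ)⁻¹ - 1) := by
  have hQ := posDef_one_add_mul_conjTranspose r
  have hdet : IsUnit (1 + r * rᴴ).det := (isUnit_iff_isUnit_det _).1 hQ.isUnit
  have hinv : ((1 + r * rᴴ)⁻¹)ᴴ = (1 + r * rᴴ)⁻¹ := hQ.inv.isHermitian
  have h1 : (1 + r * rᴴ)⁻¹ * (r * rᴴ) = 1 - (1 + r * rᴴ)⁻¹ := by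
    have h := nonsing_inv_mul _ hdet
    rw [mul_add, mul_one, add_comm] at h
    exact eq_sub_of_add_eq h
  have h2 : doubling r * (doubling r)ᴴ
      = (4 : ℂ) • (((1 + r * rᴴ)⁻¹ * (r * rᴴ)) * (1 + r * rᴴ)⁻¹) := by
    rw [doubling, conjTranspose_smul, conjTranspose_mul, hinv]
    simp only [smul_mul_assoc, mul_smul_comm, smul_smul, Matrix.mul_assoc]
    congr 1
    norm_num
  rw [h2, h1]
  generalize (1 + r * rᴴ)⁻¹ = B
  simp only [sub_mul, mul_sub, smul_mul_assoc, mul_smul_comm, smul_smul, one_mul, mul_one, smul_sub]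
  module

theorem posDef_two_smul_inv_sub_one {r : Matrix m m ℂ} (hr : ‖r‖ < 1) :
    ((2 : ℂ) • (1 + r * rᴴ)⁻¹ - 1).PosDef := by
  have hQ := posDef_one_add_mul_conjTranspose r
  have hdet : IsUnit (1 + r * rᴴ).det := (isUnit_iff_isUnit_det _).1 hQ.isUnit
  have hinv : ((1 + r * rᴴ)⁻¹)ᴴ = (1 + r * rᴴ)⁻¹ := hQ.inv.isHermitian
  have hr' := (norm_lt_one_iff_posDef r).1 hr
  have ha := posSemidef_self_mul_conjTranspose r
  have h1 : ((2 : ℂ) • (1 + r * rᴴ)⁻¹ - 1)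
      = (1 + r * rᴴ)⁻¹ * ((2 : ℂ) • (1 + r * rᴴ) - (1 + r * rᴴ) * (1 + r * rᴴ)) *
        ((1 + r * rᴴ)⁻¹)ᴴ := by
    rw [hinv, mul_sub, mul_smul_comm, nonsing_inv_mul _ hdet,
      nonsing_inv_mul_cancel_left _ _ hdet, sub_mul, mul_nonsing_inv _ hdet, smul_mul_assoc, one_mul]
  rw [h1]
  refine PosDef.conjugate ?_ ((isUnit_nonsing_inv_iff).2 hQ.isUnit)
  -- With `x = r r*` this is `1 - x² = (1 - x) + x (1 - x)`; the last product is split as `(1 - x) x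
  -- (1 - x) + x (1 - x) x`, where positivity is visible.
  have h2 : (2 : ℂ) • (1 + r * rᴴ) - (1 + r * rᴴ) * (1 + r * rᴴ)
      = (1 - r * rᴴ) + ((1 - r * rᴴ) * (r * rᴴ) * (1 - r * rᴴ)ᴴ
        + (r * rᴴ) * (1 - r * rᴴ) * (r * rᴴ)ᴴ) := by
    rw [hr'.isHermitian.eq, ha.isHermitian.eq, two_smul]
    noncomm_ring
  rw [h2]
  exact hr'.add_posSemidef ((ha.mul_mul_conjTranspose_same _).add
    (hr'.posSemidef.mul_mul_conjTranspose_same _))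

theorem norm_doubling_lt_one {r : Matrix m m ℂ} (hr : ‖r‖ < 1) : ‖doubling r‖ < 1 := by
  have h := posDef_two_smul_inv_sub_one hr
  rw [norm_lt_one_iff_posDef, one_sub_doubling]
  nth_rw 2 [← h.isHermitian.eq]
  simpa using (PosDef.one (n := m) (R := ℂ)).conjugate h.isUnit

/-- The image determines `(2 (1 + r r*)⁻¹ - 1)²`; uniqueness of the positive square root gives `1 +
r r*`, and then `r`. -/
theorem doubling_injOn : Set.InjOn (doubling (m := m)) {r | ‖r‖ < 1} := by
  intro r hr r' hr' h
  have e1 := one_sub_doubling r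
  have e2 := one_sub_doubling r'
  rw [h, e2] at e1
  have h3 : (2 : ℂ) • (1 + r' * r'ᴴ)⁻¹ - 1 = (2 : ℂ) • (1 + r * rᴴ)⁻¹ - 1 :=
    (CFC.mul_self_eq_mul_self_iff _ _ (posDef_two_smul_inv_sub_one hr').posSemidef.nonneg
      (posDef_two_smul_inv_sub_one hr).posSemidef.nonneg).1 e1
  have h4 : (1 + r' * r'ᴴ)⁻¹ = (1 + r * rᴴ)⁻¹ :=
    smul_right_injective _ (two_ne_zero (α := ℂ)) (sub_left_injective h3)
  have hU : IsUnit (1 + r * rᴴ)⁻¹ :=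
    (isUnit_nonsing_inv_iff).2 (posDef_one_add_mul_conjTranspose r).isUnit
  rw [doubling, doubling, h4] at h
  exact hU.mul_left_cancel (smul_right_injective _ (two_ne_zero (α := ℂ)) h)

theorem exists_doubling_eq {ρ : Matrix m m ℂ} (hρ : ‖ρ‖ < 1) :
    ∃ r : Matrix m m ℂ, ‖r‖ < 1 ∧ doubling r = ρ := by
  have h0 := (norm_lt_one_iff_posDef ρ).1 hρ
  -- By `one_sub_doubling`, `D` must be `2 (1 + r r*)⁻¹ - 1`. Solving for `r` gives the witness `(1
  -- + D)⁻¹ ρ`.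
  obtain ⟨D, hD, hDD⟩ : ∃ D : Matrix m m ℂ, D.PosSemidef ∧ D * D = 1 - ρ * ρᴴ :=
    ⟨CFC.sqrt (1 - ρ * ρᴴ), (CFC.sqrt_nonneg _).posSemidef,
      CFC.sqrt_mul_sqrt_self _ h0.posSemidef.nonneg⟩
  have hDpos : D.PosDef := by
    refine hD.posDef_iff_isUnit.2 ?_
    have h1 := h0.isUnit
    rw [← hDD, isUnit_iff_isUnit_det, det_mul] at h1
    exact (isUnit_iff_isUnit_det _).2 (isUnit_of_mul_isUnit_left h1)
  have hE : (1 + D).PosDef := PosDef.one.add hDpos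
  have hdet : IsUnit (1 + D).det := (isUnit_iff_isUnit_det _).1 hE.isUnit
  have hinv : ((1 + D)⁻¹)ᴴ = (1 + D)⁻¹ := hE.inv.isHermitian
  have hρρ : ρ * ρᴴ = (1 + D) * (1 - D) := by
    have : ρ * ρᴴ = 1 - D * D := by rw [hDD]; abel
    rw [this]; noncomm_ring
  have hcomm : (1 - D) * (1 + D)⁻¹ = (2 : ℂ) • (1 + D)⁻¹ - 1 := by
    have : (1 - D) = (2 : ℂ) • 1 - (1 + D) := by rw [two_smul]; abel
    rw [this, sub_mul, mul_nonsing_inv _ hdet, smul_mul_assoc, one_mul]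
  have hrr : (1 + D)⁻¹ * ρ * ((1 + D)⁻¹ * ρ)ᴴ = (2 : ℂ) • (1 + D)⁻¹ - 1 := by
    rw [conjTranspose_mul, hinv, ← hcomm]
    calc (1 + D)⁻¹ * ρ * (ρᴴ * (1 + D)⁻¹) = (1 + D)⁻¹ * (ρ * ρᴴ) * (1 + D)⁻¹ := by noncomm_ring
      _ = _ := by rw [hρρ, nonsing_inv_mul_cancel_left _ _ hdet]
  refine ⟨(1 + D)⁻¹ * ρ, ?_, ?_⟩
  · rw [norm_lt_one_iff_posDef, hrr]
    have h1 : 1 - ((2 : ℂ) • (1 + D)⁻¹ - 1)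
        = (1 + D)⁻¹ * ((2 : ℂ) • (D + D * 1 * Dᴴ)) * ((1 + D)⁻¹)ᴴ := by
      have h2 : D + D * 1 * Dᴴ = (1 + D) * (1 + D) - (1 + D) := by
        rw [hD.isHermitian.eq]; noncomm_ring
      rw [hinv, h2, mul_smul_comm, mul_sub, nonsing_inv_mul_cancel_left _ _ hdet,
        nonsing_inv_mul _ hdet, smul_mul_assoc, sub_mul, mul_nonsing_inv _ hdet, smul_sub, one_mul,
        two_smul ℂ (1 : Matrix m m ℂ)]
      abel
    rw [h1]
    refine PosDef.conjugate (PosDef.smul ?_ two_pos) ((isUnit_nonsing_inv_iff).2 hE.isUnit)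
    exact hDpos.add_posSemidef (PosSemidef.one.mul_mul_conjTranspose_same D)
  · have h3 : (1 + (1 + D)⁻¹ * ρ * ((1 + D)⁻¹ * ρ)ᴴ) = (2 : ℂ) • (1 + D)⁻¹ := by
      rw [hrr]; abel
    have h4 : ((2 : ℂ) • (1 + D)⁻¹)⁻¹ = (2 : ℂ)⁻¹ • (1 + D) := by
      refine inv_eq_left_inv ?_
      rw [smul_mul_smul_comm, mul_nonsing_inv _ hdet]
      norm_num
    rw [doubling, h3, h4, smul_mul_assoc, mul_nonsing_inv_cancel_left _ _ hdet, smul_smul]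
    norm_num

end Contractions

/-! ### Restriction to blocks as multiplication by 0-1 matrices. -/

section Selection

variable {m k l : Type*} [Fintype l] [DecidableEq l]

/-- The `0`-`1` matrix that selects the rows `f x`. -/
noncomputable def selection (f : m → l) : Matrix m l ℂ := (1 : Matrix l l ℂ).submatrix f id

theorem selection_mul (f : m → l) (M : Matrix l k ℂ) : selection f * M = M.submatrix f id := by
  ext x y
  simp [selection, mul_apply, one_apply]

theorem mul_conjTranspose_selection (f : m → l) (M : Matrix k l ℂ) :
    M * (selection f)ᴴ = M.submatrix id f := by
  ext x y
  simp [selection, mul_apply, one_apply, apply_ite]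

end Selection

/-! ### Block Toeplitz matrices and their displacement identity. -/

section Toeplitz

variable {p : ℕ}

/-- The coefficients `s_k` determined by `a_k = s_{-k}`, `k ≥ 0`, and `s_k = s_{-k}^*`. -/
noncomputable def coeff (a : ℕ → Matrix (Fin p) (Fin p) ℂ) (k : ℤ) : Matrix (Fin p) (Fin p) ℂ :=
  if k ≤ 0 then a k.natAbs else (a k.natAbs)ᴴ

theorem coeff_neg_natCast (a : ℕ → Matrix (Fin p) (Fin p) ℂ) (k : ℕ) : coeff a (-k) = a k := by
  simp [coeff]

theorem coeff_zero (a : ℕ → Matrix (Fin p) (Fin p) ℂ) : coeff a 0 = a 0 := by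
  simp [coeff]

theorem coeff_neg {a : ℕ → Matrix (Fin p) (Fin p) ℂ} (ha : (a 0).IsHermitian) (k : ℤ) :
    coeff a (-k) = (coeff a k)ᴴ := by
  rcases lt_trichotomy k 0 with h | rfl | h
  · simp [coeff, h.le, h.not_ge]
  · simp [coeff, ha.eq]
  · simp [coeff, h.le, h.not_ge]

/-- The block Toeplitz matrix `{s_{j-i}}` with `s_{-k} = a_k` and `s_k = a_k^*`, `k ≥ 0`. -/
noncomputable def toeplitz (a : ℕ → Matrix (Fin p) (Fin p) ℂ) (n : ℕ) :
    Matrix (Fin n × Fin p) (Fin n × Fin p) ℂ :=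
  of fun x y => coeff a (((y.1 : ℕ) : ℤ) - ((x.1 : ℕ) : ℤ)) x.2 y.2

theorem block_toeplitz (a : ℕ → Matrix (Fin p) (Fin p) ℂ) {n : ℕ} (i j : Fin n) :
    block (toeplitz a n) i j = coeff a (((j : ℕ) : ℤ) - ((i : ℕ) : ℤ)) := rfl

theorem isBlockToeplitz_toeplitz (a : ℕ → Matrix (Fin p) (Fin p) ℂ) (n : ℕ) :
    IsBlockToeplitz (toeplitz a n) := ⟨coeff a, fun _ _ => rfl⟩

theorem isHermitian_toeplitz {a : ℕ → Matrix (Fin p) (Fin p) ℂ} (ha : (a 0).IsHermitian) (n : ℕ) :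
    (toeplitz a n).IsHermitian := by
  ext x y
  simp only [toeplitz, conjTranspose_apply, of_apply]
  rw [← neg_sub ((x.1 : ℕ) : ℤ), coeff_neg ha, conjTranspose_apply]

theorem exists_eq_toeplitz {n : ℕ} {S : Matrix (Fin n × Fin p) (Fin n × Fin p) ℂ}
    (hS : IsBlockToeplitz S) (hH : S.IsHermitian) :
    ∃ a : ℕ → Matrix (Fin p) (Fin p) ℂ, S = toeplitz a n := by
  obtain ⟨s, hs⟩ := hS
  have hs' : ∀ x y, S x y = s (((y.1 : ℕ) : ℤ) - ((x.1 : ℕ) : ℤ)) x.2 y.2 := fun x y =>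
    congrFun (congrFun (hs x.1 y.1) x.2) y.2
  refine ⟨fun k => s (-k), ?_⟩
  ext x y
  simp only [toeplitz, of_apply, coeff]
  split_ifs with h
  · rw [hs']
    congr 2
    omega
  · rw [← hH.apply, hs', conjTranspose_apply]
    congr 3
    omega

theorem isHermitian_of_isHermitian_toeplitz {a : ℕ → Matrix (Fin p) (Fin p) ℂ} {n : ℕ}
    (hn : 1 ≤ n) (h : (toeplitz a n).IsHermitian) : (a 0).IsHermitian := by
  ext i k
  have := h.apply (⟨0, hn⟩, i) (⟨0, hn⟩, k)
  simpa [toeplitz, coeff_zero] using this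

theorem posDef_toeplitz_of_le {a : ℕ → Matrix (Fin p) (Fin p) ℂ} {k n : ℕ} (hk : k ≤ n)
    (h : (toeplitz a n).PosDef) : (toeplitz a k).PosDef :=
  h.submatrix (e := Prod.map (Fin.castLE hk) id)
    ((Fin.castLE_injective hk).prodMap Function.injective_id)

theorem toeplitz_congr {a b : ℕ → Matrix (Fin p) (Fin p) ℂ} {n : ℕ} (h : ∀ k < n, a k = b k) :
    toeplitz a n = toeplitz b n := by
  ext x y
  have h1 := h (((y.1 : ℕ) : ℤ) - ((x.1 : ℕ) : ℤ)).natAbs (by omega)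
  simp only [toeplitz, of_apply, coeff, h1]

/-- The block column with blocks `s₀/2 + s_{-1} + ⋯ + s_{-i} + i ν`. -/
noncomputable def phi (a : ℕ → Matrix (Fin p) (Fin p) ℂ) (ν : Matrix (Fin p) (Fin p) ℂ) (i : ℕ) :
    Matrix (Fin p) (Fin p) ℂ :=
  (1 / 2 : ℂ) • a 0 + ∑ l ∈ Finset.range i, a (l + 1) + Complex.I • ν

theorem sum_Ioc_zero_eq_sum_range {M : Type*} [AddCommMonoid M] {m : ℕ} (f : ℕ → M)
    (i : Fin (m + 1)) : ∑ l ∈ Finset.Ioc 0 i, f (l : ℕ) = ∑ l ∈ Finset.range i, f (l + 1) := by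
  symm
  refine Finset.sum_bij (fun l hl => ⟨l + 1, ?_⟩) ?_ ?_ ?_ ?_
  · have := Finset.mem_range.1 hl
    omega
  · intro l hl
    have := Finset.mem_range.1 hl
    simp only [Finset.mem_Ioc, Fin.lt_def, Fin.le_def, Fin.val_zero]
    omega
  · intro l _ l' _ h
    simpa using h
  · intro l hl
    simp only [Finset.mem_Ioc, Fin.lt_def, Fin.le_def, Fin.val_zero] at hl
    exact ⟨l - 1, Finset.mem_range.2 (by omega), Fin.ext (Nat.sub_add_cancel hl.1)⟩
  · intro l _
    rfl

theorem Phi2_toeplitz_apply (a : ℕ → Matrix (Fin p) (Fin p) ℂ) (ν : Matrix (Fin p) (Fin p) ℂ)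
    (m : ℕ) (x : Fin (m + 1) × Fin p) (b : Fin p) :
    Phi2 (toeplitz a (m + 1)) ν x b = phi a ν x.1 x.2 b := by
  have h : ∑ l ∈ Finset.Ioc 0 x.1, block (toeplitz a (m + 1)) l 0
      = ∑ l ∈ Finset.range (x.1 : ℕ), a (l + 1) := by
    rw [← sum_Ioc_zero_eq_sum_range]
    refine Finset.sum_congr rfl fun l _ => ?_
    simp [block_toeplitz, coeff_neg_natCast]
  have h0 : block (toeplitz a (m + 1)) 0 0 = a 0 := by simp [block_toeplitz, coeff_zero]
  have h1 : (Phi1 m p * ν) x b = ν x.2 b := by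
    simp [Phi1, mul_apply, one_apply]
  calc Phi2 (toeplitz a (m + 1)) ν x b
      = ((1 / 2 : ℂ) • block (toeplitz a (m + 1)) 0 0
          + ∑ l ∈ Finset.Ioc 0 x.1, block (toeplitz a (m + 1)) l 0) x.2 b
        + Complex.I * (Phi1 m p * ν) x b := rfl
    _ = _ := by rw [h, h0, h1]; rfl

/-- The block lower triangular matrix with `I / 2` on the block diagonal and `I` below it. -/
noncomputable def lowerHalf (n p : ℕ) : Matrix (Fin n × Fin p) (Fin n × Fin p) ℂ :=
  of fun x y => if x.2 = y.2 then (if x.1 = y.1 then 1 / 2 else if y.1 < x.1 then 1 else 0) else 0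

theorem lowerHalf_mul_apply {n : ℕ} {k : Type*} (M : Matrix (Fin n × Fin p) k ℂ)
    (f : ℕ → Fin p → k → ℂ) (hf : ∀ i b y, M (i, b) y = f i b y) (x : Fin n × Fin p) (y : k) :
    (lowerHalf n p * M) x y
      = (1 / 2) * f x.1 x.2 y + ∑ r ∈ Finset.range x.1, f r x.2 y := by
  obtain ⟨i, c⟩ := x
  have h1 : (lowerHalf n p * M) (i, c) y
      = ∑ r : Fin n, (if (i : ℕ) = r then 1 / 2 else if (r : ℕ) < i then 1 else 0) * f r c y := by
    simp only [lowerHalf, mul_apply, of_apply, Fintype.sum_prod_type, hf, ite_mul, zero_mul,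
      Fin.ext_iff, Fin.lt_def]
    refine Finset.sum_congr rfl fun r _ => ?_
    simp [← Fin.ext_iff]
  rw [h1, Fin.sum_univ_eq_sum_range
    (fun r => (if (i : ℕ) = r then (1 / 2 : ℂ) else if r < i then 1 else 0) * f r c y)]
  have h2 : ∀ r : ℕ, (if (i : ℕ) = r then (1 / 2 : ℂ) else if r < i then 1 else 0) * f r c y
      = (if (i : ℕ) = r then (1 / 2) * f r c y else 0) + (if r < i then f r c y else 0) := by
    intro r
    rcases lt_trichotomy (i : ℕ) r with h | h | h
    · simp [h.ne, h.not_gt]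
    · simp [h]
    · simp [h.ne', h]
  simp only [h2, Finset.sum_add_distrib]
  congr 1
  · rw [Finset.sum_ite_eq, if_pos (Finset.mem_range.2 i.2)]
  · rw [← Finset.sum_filter]
    refine Finset.sum_congr ?_ fun _ _ => rfl
    ext r
    simp only [Finset.mem_filter, Finset.mem_range]
    have := i.2
    omega

/-- This is the displacement identity in one entry, without `ν`. In the induction on `k`, the
passage to `k + 1` is a telescoping sum over `r < l`. -/
theorem toeplitz_sum_identity (σ : ℤ → ℂ) (k l : ℕ) :
    ((1 / 2) * σ (l - k) + ∑ r ∈ Finset.range k, σ (l - r))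
        + ((1 / 2) * σ (l - k) + ∑ r ∈ Finset.range l, σ (r - k))
      = ((1 / 2) * σ 0 + ∑ r ∈ Finset.range k, σ (-(r + 1 : ℕ)))
        + ((1 / 2) * σ 0 + ∑ r ∈ Finset.range l, σ (r + 1 : ℕ)) := by
  induction k with
  | zero =>
    have h := (Finset.sum_range_succ (fun r : ℕ => σ r) l).symm.trans
      (Finset.sum_range_succ' (fun r : ℕ => σ r) l)
    simp only [Nat.cast_zero] at h
    simp only [Nat.cast_zero, sub_zero, Finset.range_zero, Finset.sum_empty]
    linear_combination h
  | succ k ih =>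
    have h := Finset.sum_range_sub (fun r : ℕ => σ ((r : ℤ) - (k + 1 : ℕ))) l
    have h' : ∀ r : ℕ, ((r + 1 : ℕ) : ℤ) - (k + 1 : ℕ) = r - k := by intro r; push_cast; ring
    simp only [h', Finset.sum_sub_distrib] at h
    rw [Finset.sum_range_succ, Finset.sum_range_succ]
    have e : ((0 : ℕ) : ℤ) - (k + 1 : ℕ) = -(k + 1 : ℕ) := by simp
    rw [e] at h
    linear_combination ih - h

theorem lowerHalf_mul_toeplitz_apply (a : ℕ → Matrix (Fin p) (Fin p) ℂ) (n : ℕ)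
    (x y : Fin n × Fin p) :
    (lowerHalf n p * toeplitz a n) x y
      = (1 / 2) * coeff a ((y.1 : ℕ) - (x.1 : ℕ)) x.2 y.2
        + ∑ r ∈ Finset.range x.1, coeff a ((y.1 : ℕ) - r) x.2 y.2 := by
  rw [lowerHalf_mul_apply (toeplitz a n)
    (fun (r : ℕ) b (z : Fin n × Fin p) => coeff a (((z.1 : ℕ) : ℤ) - (r : ℤ)) b z.2)]
  intro i b z
  rfl

theorem star_coeff_apply {a : ℕ → Matrix (Fin p) (Fin p) ℂ} (ha : (a 0).IsHermitian) (k : ℤ)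
    (b b' : Fin p) : star (coeff a k b' b) = coeff a (-k) b b' := by
  rw [coeff_neg ha, conjTranspose_apply]

theorem star_lowerHalf_mul_toeplitz_apply {a : ℕ → Matrix (Fin p) (Fin p) ℂ}
    (ha : (a 0).IsHermitian) (n : ℕ) (x y : Fin n × Fin p) :
    star ((lowerHalf n p * toeplitz a n) y x)
      = (1 / 2) * coeff a ((y.1 : ℕ) - (x.1 : ℕ)) x.2 y.2
        + ∑ r ∈ Finset.range y.1, coeff a (r - (x.1 : ℕ)) x.2 y.2 := by
  have h : star (1 / 2 : ℂ) = 1 / 2 := by simp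
  rw [lowerHalf_mul_toeplitz_apply, star_add, star_mul', star_sum, h]
  simp only [star_coeff_apply ha, neg_sub]

theorem phi_apply (a : ℕ → Matrix (Fin p) (Fin p) ℂ) (ν : Matrix (Fin p) (Fin p) ℂ) (i : ℕ)
    (b b' : Fin p) :
    phi a ν i b b' = (1 / 2) * coeff a 0 b b'
      + ∑ r ∈ Finset.range i, coeff a (-(r + 1 : ℕ)) b b' + Complex.I * ν b b' := by
  simp only [phi, coeff_zero, coeff_neg_natCast, Matrix.sum_apply, Matrix.add_apply, Matrix.smul_apply,
    smul_eq_mul]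

theorem star_phi_apply {a : ℕ → Matrix (Fin p) (Fin p) ℂ} (ha : (a 0).IsHermitian)
    {ν : Matrix (Fin p) (Fin p) ℂ} (hν : ν.IsHermitian) (i : ℕ) (b b' : Fin p) :
    star (phi a ν i b' b) = (1 / 2) * coeff a 0 b b'
      + ∑ r ∈ Finset.range i, coeff a (r + 1 : ℕ) b b' - Complex.I * ν b b' := by
  have h : star (1 / 2 : ℂ) = 1 / 2 := by simp
  have hI : star Complex.I = -Complex.I := by simp
  rw [phi_apply, star_add, star_add, star_mul', star_sum, star_mul', h, hI, hν.apply]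
  simp only [star_coeff_apply ha, neg_neg, neg_zero]
  ring

/-- The displacement identity on which both norm identities rest. The contributions of `ν` cancel
because `ν` is self-adjoint. Positivity of the Toeplitz matrix plays no role. -/
theorem lowerHalf_mul_toeplitz_add {a : ℕ → Matrix (Fin p) (Fin p) ℂ} (ha : (a 0).IsHermitian)
    {ν : Matrix (Fin p) (Fin p) ℂ} (hν : ν.IsHermitian) (m : ℕ) :
    lowerHalf (m + 1) p * toeplitz a (m + 1) + toeplitz a (m + 1) * (lowerHalf (m + 1) p)ᴴ
      = Phi1 m p * (Phi2 (toeplitz a (m + 1)) ν)ᴴ + Phi2 (toeplitz a (m + 1)) ν * (Phi1 m p)ᴴ := by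
  have e1 : toeplitz a (m + 1) * (lowerHalf (m + 1) p)ᴴ
      = (lowerHalf (m + 1) p * toeplitz a (m + 1))ᴴ := by
    rw [conjTranspose_mul, (isHermitian_toeplitz ha (m + 1)).eq]
  ext ⟨i, b⟩ ⟨i', b'⟩
  have e2 : (Phi1 m p * (Phi2 (toeplitz a (m + 1)) ν)ᴴ) (i, b) (i', b')
      = star (phi a ν i' b' b) := by
    simp [Phi1, mul_apply, one_apply, Phi2_toeplitz_apply]
  have e3 : (Phi2 (toeplitz a (m + 1)) ν * (Phi1 m p)ᴴ) (i, b) (i', b') = phi a ν i b b' := by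
    simp [Phi1, mul_apply, one_apply, Phi2_toeplitz_apply, apply_ite]
  rw [Matrix.add_apply, Matrix.add_apply, e1, conjTranspose_apply, star_lowerHalf_mul_toeplitz_apply ha,
    lowerHalf_mul_toeplitz_apply, e2, e3, star_phi_apply ha hν, phi_apply]
  have h := toeplitz_sum_identity (fun k => coeff a k b b') i i'
  dsimp only at h ⊢
  linear_combination h

theorem lastBlockRow_eq_selection (m p : ℕ) :
    lastBlockRow m p = selection fun b => (Fin.last m, b) := by
  ext b x
  simp [lastBlockRow, selection, one_apply, Prod.ext_iff, eq_comm]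

theorem lowerHalf_mul_lastBlockRow (m : ℕ) :
    lowerHalf (m + 1) p * (lastBlockRow m p)ᴴ = (1 / 2 : ℂ) • (lastBlockRow m p)ᴴ := by
  rw [lastBlockRow_eq_selection, mul_conjTranspose_selection]
  ext ⟨i, b⟩ b'
  have : ¬ Fin.last m < i := (Fin.le_last _).not_gt
  by_cases h1 : i = Fin.last m <;> by_cases h2 : b = b' <;>
    simp [lowerHalf, selection, one_apply, this, h1, h2]

end Toeplitz

/-! ### The Dirac coefficients in terms of a Cayley transform. -/

section Cayley

variable {p m : ℕ}

theorem invSqrt_isHermitian (M : Matrix (Fin p) (Fin p) ℂ) : (invSqrt M)ᴴ = invSqrt M :=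
  (cfc_predicate (R := ℝ) (p := IsSelfAdjoint) (fun x : ℝ => (Real.sqrt x)⁻¹) M)

theorem invSqrt_mul_invSqrt {M : Matrix (Fin p) (Fin p) ℂ} (hM : M.PosDef) :
    invSqrt M * invSqrt M = M⁻¹ := by
  have hsa : IsSelfAdjoint M := hM.isHermitian
  have hpos : ∀ x ∈ spectrum ℝ M, 0 < x :=
    (StarOrderedRing.isStrictlyPositive_iff_spectrum_pos (R := ℝ) M hsa).1
      (isStrictlyPositive_iff_posDef.2 hM)
  have hc : ContinuousOn (fun x : ℝ => (Real.sqrt x)⁻¹) (spectrum ℝ M) :=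
    Real.continuous_sqrt.continuousOn.inv₀ fun x hx => (Real.sqrt_pos.2 (hpos x hx)).ne'
  symm
  refine inv_eq_left_inv ?_
  rw [invSqrt, ← cfc_mul _ _ M hc hc]
  nth_rw 2 [← cfc_id' ℝ M hsa]
  rw [← cfc_mul (fun x : ℝ => (Real.sqrt x)⁻¹ * (Real.sqrt x)⁻¹) (fun x => x) M (hc.mul hc)
    (continuousOn_id' _), ← cfc_one ℝ M hsa]
  refine cfc_congr fun x hx => ?_
  have h := hpos x hx
  have h1 : Real.sqrt x ≠ 0 := (Real.sqrt_pos.2 h).ne'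
  have h2 := Real.mul_self_sqrt h.le
  simp only [Pi.one_apply]
  field_simp
  rw [sq, h2]

/-- Substituting `R = P r` gives `P (1 - r r*) P* = 2 q`, hence `P* q⁻¹ P = 2 (1 - r r*)⁻¹`. In the
quotient the factor `(1 - r r*)⁻¹` cancels. -/
theorem isUnit_sub_one_and_inv_mul_eq_doubling {P R q : Matrix (Fin p) (Fin p) ℂ} (hq : q.PosDef)
    (h : P * Pᴴ = R * Rᴴ + (2 : ℂ) • q) :
    IsUnit (Pᴴ * q⁻¹ * P - 1) ∧ (Pᴴ * q⁻¹ * P - 1)⁻¹ * (Pᴴ * q⁻¹ * R) = doubling (P⁻¹ * R) := by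
  have h2q : ((2 : ℂ) • q).PosDef := hq.smul two_pos
  have hP : IsUnit P := isUnit_of_mul_conjTranspose_eq h2q h
  have hPdet : IsUnit P.det := (isUnit_iff_isUnit_det _).1 hP
  have hqdet : IsUnit q.det := (isUnit_iff_isUnit_det _).1 hq.isUnit
  obtain ⟨r, hr, hR⟩ : ∃ r, P⁻¹ * R = r ∧ R = P * r :=
    ⟨_, rfl, (mul_nonsing_inv_cancel_left _ _ hPdet).symm⟩
  rw [hr]
  have hA := (posDef_one_add_mul_conjTranspose r).isUnit
  have hAdet : IsUnit (1 + r * rᴴ).det := (isUnit_iff_isUnit_det _).1 hA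
  have hB : P * ((1 - r * rᴴ) * Pᴴ) = (2 : ℂ) • q := by
    rw [← add_sub_cancel_left (R * Rᴴ) ((2 : ℂ) • q), ← h, hR, conjTranspose_mul]
    simp only [Matrix.sub_mul, Matrix.mul_sub, Matrix.mul_assoc, Matrix.one_mul]
  have hG : (1 - r * rᴴ) * (Pᴴ * q⁻¹ * P) = (2 : ℂ) • 1 := by
    refine hP.mul_left_cancel ?_
    calc P * ((1 - r * rᴴ) * (Pᴴ * q⁻¹ * P)) = P * ((1 - r * rᴴ) * Pᴴ) * q⁻¹ * P := by
          simp only [Matrix.mul_assoc]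
      _ = P * (2 : ℂ) • 1 := by
          rw [hB, smul_mul_assoc, mul_nonsing_inv _ hqdet, smul_mul_assoc, one_mul, mul_smul_comm,
            mul_one]
  have hc : (1 - r * rᴴ) * (Pᴴ * q⁻¹ * P - 1) = 1 + r * rᴴ := by
    rw [mul_sub, hG, mul_one, two_smul]
    abel
  have hinv : (1 + r * rᴴ)⁻¹ * (1 - r * rᴴ) * (Pᴴ * q⁻¹ * P - 1) = 1 := by
    rw [mul_assoc, hc, nonsing_inv_mul _ hAdet]
  refine ⟨IsUnit.of_mul_eq_one_right _ hinv, ?_⟩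
  rw [inv_eq_left_inv hinv, doubling]
  calc (1 + r * rᴴ)⁻¹ * (1 - r * rᴴ) * (Pᴴ * q⁻¹ * R)
      = (1 + r * rᴴ)⁻¹ * ((1 - r * rᴴ) * (Pᴴ * q⁻¹ * P)) * r := by
        rw [hR]; simp only [Matrix.mul_assoc]
    _ = _ := by rw [hG, mul_smul_comm, mul_one, smul_mul_assoc]

theorem lastBlockRow_mul_conjTranspose (m p : ℕ) :
    lastBlockRow m p * (lastBlockRow m p)ᴴ = 1 := by
  rw [lastBlockRow_eq_selection, mul_conjTranspose_selection]
  ext b b'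
  simp [selection, one_apply]

theorem posDef_t {S : Matrix (Fin (m + 1) × Fin p) (Fin (m + 1) × Fin p) ℂ} (hS : S.PosDef) :
    (t S).PosDef := by
  refine hS.inv.mul_mul_conjTranspose_same ?_
  intro x y h
  have h1 := congrArg (fun v => v ᵥ* (lastBlockRow m p)ᴴ) h
  simpa [vecMul_vecMul, lastBlockRow_mul_conjTranspose] using h1

/-- The row `w` whose last block is `I` and such that `w S` vanishes outside of the last block. -/
noncomputable def normalizedLastRow (S : Matrix (Fin (m + 1) × Fin p) (Fin (m + 1) × Fin p) ℂ) :
    Matrix (Fin p) (Fin (m + 1) × Fin p) ℂ :=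
  (t S)⁻¹ * (lastBlockRow m p * S⁻¹)

theorem normalizedLastRow_mul {S : Matrix (Fin (m + 1) × Fin p) (Fin (m + 1) × Fin p) ℂ}
    (hS : S.PosDef) : normalizedLastRow S * S = (t S)⁻¹ * lastBlockRow m p := by
  rw [normalizedLastRow, Matrix.mul_assoc, Matrix.mul_assoc,
    nonsing_inv_mul _ ((isUnit_iff_isUnit_det _).1 hS.isUnit), Matrix.mul_one]

theorem normalizedLastRow_mul_lastBlockRow
    {S : Matrix (Fin (m + 1) × Fin p) (Fin (m + 1) × Fin p) ℂ} (hS : S.PosDef) :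
    normalizedLastRow S * (lastBlockRow m p)ᴴ = 1 := by
  rw [normalizedLastRow, Matrix.mul_assoc]
  exact nonsing_inv_mul _ ((isUnit_iff_isUnit_det _).1 (posDef_t hS).isUnit)

/-- Allows `cayley` to be computed from a row found by other means, such as `extensionRow`. -/
theorem eq_normalizedLastRow {S : Matrix (Fin (m + 1) × Fin p) (Fin (m + 1) × Fin p) ℂ}
    (hS : S.PosDef) {w : Matrix (Fin p) (Fin (m + 1) × Fin p) ℂ} {q : Matrix (Fin p) (Fin p) ℂ}
    (hw : w * S = q * lastBlockRow m p) (hw1 : w * (lastBlockRow m p)ᴴ = 1) :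
    w = normalizedLastRow S := by
  have h1 : w = q * (lastBlockRow m p * S⁻¹) := by
    rw [← Matrix.mul_assoc, ← hw,
      mul_nonsing_inv_cancel_right _ _ ((isUnit_iff_isUnit_det _).1 hS.isUnit)]
  have h2 : q * t S = 1 := by
    rw [← hw1, h1, t]; simp only [Matrix.mul_assoc]
  rw [h1, normalizedLastRow, inv_eq_left_inv h2]

/-- `w (Φ₂ + Φ₁)`. -/
noncomputable def plusPart (w : Matrix (Fin p) (Fin (m + 1) × Fin p) ℂ)
    (S : Matrix (Fin (m + 1) × Fin p) (Fin (m + 1) × Fin p) ℂ) (ν : Matrix (Fin p) (Fin p) ℂ) :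
    Matrix (Fin p) (Fin p) ℂ :=
  w * (Phi2 S ν + Phi1 m p)

/-- `w (Φ₂ - Φ₁)`. -/
noncomputable def minusPart (w : Matrix (Fin p) (Fin (m + 1) × Fin p) ℂ)
    (S : Matrix (Fin (m + 1) × Fin p) (Fin (m + 1) × Fin p) ℂ) (ν : Matrix (Fin p) (Fin p) ℂ) :
    Matrix (Fin p) (Fin p) ℂ :=
  w * (Phi2 S ν - Phi1 m p)

/-- The Cayley transform `(X + Y)⁻¹ (Y - X)` of the last rows `X`, `Y` of `S⁻¹ Φ₁`, `S⁻¹ Φ₂`. -/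
noncomputable def cayley (S : Matrix (Fin (m + 1) × Fin p) (Fin (m + 1) × Fin p) ℂ)
    (ν : Matrix (Fin p) (Fin p) ℂ) : Matrix (Fin p) (Fin p) ℂ :=
  (plusPart (normalizedLastRow S) S ν)⁻¹ * minusPart (normalizedLastRow S) S ν

/-- Compress the displacement identity by `w` on both sides: since `w T = q e` and `e L* = e / 2`,
each term on the left gives `q / 2`. Only self-adjointness is needed, so this applies to an
extension not yet known to be positive definite. -/
theorem plusPart_mul_conjTranspose {a : ℕ → Matrix (Fin p) (Fin p) ℂ} (ha : (a 0).IsHermitian)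
    {ν : Matrix (Fin p) (Fin p) ℂ} (hν : ν.IsHermitian)
    {w : Matrix (Fin p) (Fin (m + 1) × Fin p) ℂ} {q : Matrix (Fin p) (Fin p) ℂ}
    (hw : w * toeplitz a (m + 1) = q * lastBlockRow m p) (hw1 : w * (lastBlockRow m p)ᴴ = 1) :
    plusPart w (toeplitz a (m + 1)) ν * (plusPart w (toeplitz a (m + 1)) ν)ᴴ
      = minusPart w (toeplitz a (m + 1)) ν * (minusPart w (toeplitz a (m + 1)) ν)ᴴ
        + (2 : ℂ) • q := by
  have hT := isHermitian_toeplitz ha (m + 1)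
  have hid := lowerHalf_mul_toeplitz_add ha hν m
  set T := toeplitz a (m + 1)
  set e := lastBlockRow m p
  have hew : e * wᴴ = 1 := by
    rw [← conjTranspose_conjTranspose (e * wᴴ), conjTranspose_mul, conjTranspose_conjTranspose, hw1,
      conjTranspose_one]
  have hq : w * T * wᴴ = q := by rw [hw, Matrix.mul_assoc, hew, Matrix.mul_one]
  have hqH : qᴴ = q := by
    rw [← hq, conjTranspose_mul, conjTranspose_mul, conjTranspose_conjTranspose, hT.eq,
      Matrix.mul_assoc]
  have h1 : w * (T * (lowerHalf (m + 1) p)ᴴ) * wᴴ = (1 / 2 : ℂ) • q := by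
    have h2 : e * (lowerHalf (m + 1) p)ᴴ = (1 / 2 : ℂ) • e := by
      have := congrArg conjTranspose (lowerHalf_mul_lastBlockRow (p := p) m)
      simpa [conjTranspose_mul, conjTranspose_smul] using this
    rw [← Matrix.mul_assoc, hw, Matrix.mul_assoc q, h2, Matrix.mul_smul, Matrix.smul_mul,
      Matrix.mul_assoc, hew, Matrix.mul_one]
  have h3 : w * (lowerHalf (m + 1) p * T) * wᴴ = (1 / 2 : ℂ) • q := by
    have := congrArg conjTranspose h1
    simpa [conjTranspose_mul, conjTranspose_smul, hT.eq, hqH, Matrix.mul_assoc] using this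
  have h4 : w * (Phi1 m p * (Phi2 T ν)ᴴ + Phi2 T ν * (Phi1 m p)ᴴ) * wᴴ = q := by
    rw [← hid, Matrix.mul_add, Matrix.add_mul, h1, h3]
    module
  have h5 : plusPart w T ν * (plusPart w T ν)ᴴ - minusPart w T ν * (minusPart w T ν)ᴴ
      = (2 : ℂ) • (w * (Phi1 m p * (Phi2 T ν)ᴴ + Phi2 T ν * (Phi1 m p)ᴴ) * wᴴ) := by
    simp only [plusPart, minusPart, conjTranspose_mul, conjTranspose_add, conjTranspose_sub,
      Matrix.mul_add, Matrix.add_mul, Matrix.mul_sub, Matrix.sub_mul, Matrix.mul_assoc]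
    module
  rw [h4] at h5
  rw [← h5]
  abel

theorem fromCols_mul_K (X Y : Matrix (Fin p) (Fin p) ℂ) :
    fromCols X Y * K p = ((Real.sqrt 2 : ℝ) : ℂ)⁻¹ • fromCols (Y + X) (Y - X) := by
  rw [K, Matrix.mul_smul, fromCols_mul_fromBlocks]
  congr 2
  · simp [add_comm]
  · simp [sub_eq_add_neg, add_comm]

/-- Since `[X Y] K = 2^{-1/2} t [P R]`, the factor 2 absorbs the two square roots, and `t t⁻¹ t = t`
remains in the middle. -/
theorem diracMatrix_blocks {S : Matrix (Fin (m + 1) × Fin p) (Fin (m + 1) × Fin p) ℂ}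
    (hS : S.PosDef) (ν : Matrix (Fin p) (Fin p) ℂ) :
    (2 : ℂ) • ((K p)ᴴ * (beta S ν)ᴴ * beta S ν * K p)
      = fromBlocks
        ((plusPart (normalizedLastRow S) S ν)ᴴ * t S * plusPart (normalizedLastRow S) S ν)
        ((plusPart (normalizedLastRow S) S ν)ᴴ * t S * minusPart (normalizedLastRow S) S ν)
        ((minusPart (normalizedLastRow S) S ν)ᴴ * t S * plusPart (normalizedLastRow S) S ν)
        ((minusPart (normalizedLastRow S) S ν)ᴴ * t S * minusPart (normalizedLastRow S) S ν) := by
  have ht := posDef_t hS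
  have htdet : IsUnit (t S).det := (isUnit_iff_isUnit_det _).1 ht.isUnit
  have h1 : lastBlockRow m p * S⁻¹ = t S * normalizedLastRow S := by
    rw [normalizedLastRow, mul_nonsing_inv_cancel_left _ _ htdet]
  have h2 : XY S ν * K p = ((Real.sqrt 2 : ℝ) : ℂ)⁻¹ •
      (t S * fromCols (plusPart (normalizedLastRow S) S ν)
        (minusPart (normalizedLastRow S) S ν)) := by
    rw [XY, h1, mul_fromCols, fromCols_mul_K, mul_fromCols]
    simp only [plusPart, minusPart, Matrix.mul_add, Matrix.mul_sub, Matrix.mul_assoc]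
  have h3 : (K p)ᴴ * (beta S ν)ᴴ * beta S ν * K p = (XY S ν * K p)ᴴ * (t S)⁻¹ * (XY S ν * K p) := by
    rw [← invSqrt_mul_invSqrt ht, beta, conjTranspose_mul, conjTranspose_mul, invSqrt_isHermitian]
    simp only [Matrix.mul_assoc]
  have h4 : star (((Real.sqrt 2 : ℝ) : ℂ)⁻¹) = ((Real.sqrt 2 : ℝ) : ℂ)⁻¹ := by
    rw [star_inv₀, Complex.star_def, Complex.conj_ofReal]
  have h5 : (2 : ℂ) * (((Real.sqrt 2 : ℝ) : ℂ)⁻¹ * ((Real.sqrt 2 : ℝ) : ℂ)⁻¹) = 1 := by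
    rw [← mul_inv, ← Complex.ofReal_mul, Real.mul_self_sqrt (by norm_num)]
    norm_num
  set F := fromCols (plusPart (normalizedLastRow S) S ν) (minusPart (normalizedLastRow S) S ν)
  have h6 : (2 : ℂ) • ((K p)ᴴ * (beta S ν)ᴴ * beta S ν * K p) = Fᴴ * t S * F := by
    rw [h3, h2, conjTranspose_smul, h4]
    simp only [Matrix.smul_mul, Matrix.mul_smul, smul_smul]
    rw [h5, one_smul, conjTranspose_mul, ht.isHermitian.eq, Matrix.mul_assoc Fᴴ,
      mul_nonsing_inv _ htdet, Matrix.mul_one, Matrix.mul_assoc]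
  rw [h6, conjTranspose_fromCols_eq_fromRows_conjTranspose, fromRows_mul, fromRows_mul_fromCols]

theorem toBlocks₁₁_sub_j (M : Matrix (Fin p ⊕ Fin p) (Fin p ⊕ Fin p) ℂ) :
    (M - j p).toBlocks₁₁ = M.toBlocks₁₁ - 1 := rfl

theorem toBlocks₁₂_sub_j (M : Matrix (Fin p ⊕ Fin p) (Fin p ⊕ Fin p) ℂ) :
    (M - j p).toBlocks₁₂ = M.toBlocks₁₂ := by
  ext b b'
  simp [j, toBlocks₁₂]

theorem verblunsky_spec {n : ℕ} {a : ℕ → Matrix (Fin p) (Fin p) ℂ} (hT : (toeplitz a n).PosDef)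
    {ν : Matrix (Fin p) (Fin p) ℂ} (hν : ν.IsHermitian) (k : Fin n) :
    IsUnit (diracCoeff (toeplitz a n) ν k).toBlocks₁₁ ∧
      ‖cayley (toeplitz a (k + 1)) ν‖ < 1 ∧
      verblunsky (toeplitz a n) ν k = doubling (cayley (toeplitz a (k + 1)) ν) := by
  have ha := isHermitian_of_isHermitian_toeplitz k.pos hT.isHermitian
  have hS : (toeplitz a (k + 1)).PosDef := posDef_toeplitz_of_le k.2 hT
  have ht := posDef_t hS
  have key := plusPart_mul_conjTranspose ha hν (normalizedLastRow_mul hS)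
    (normalizedLastRow_mul_lastBlockRow hS)
  have hcay := isUnit_sub_one_and_inv_mul_eq_doubling ht.inv key
  rw [nonsing_inv_nonsing_inv _ ((isUnit_iff_isUnit_det _).1 ht.isUnit)] at hcay
  -- The leading part of `toeplitz a n` is `toeplitz a (k + 1)` by definition.
  have hC : diracCoeff (toeplitz a n) ν k = _ - j p :=
    congrArg (· - j p) (diracMatrix_blocks hS ν)
  have h11 := congrArg toBlocks₁₁ hC
  have h12 := congrArg toBlocks₁₂ hC
  rw [toBlocks₁₁_sub_j, toBlocks_fromBlocks₁₁] at h11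
  rw [toBlocks₁₂_sub_j, toBlocks_fromBlocks₁₂] at h12
  rw [verblunsky, h11, h12]
  exact ⟨hcay.1, norm_inv_mul_lt_one (ht.inv.smul two_pos) key, hcay.2⟩

end Cayley

/-! ### Extension of a positive definite Toeplitz matrix by one block. -/

section Extension

variable {p m : ℕ}

/-- The matrix `[I 0]` that deletes the last block row. -/
noncomputable def dropLast (m p : ℕ) : Matrix (Fin (m + 1) × Fin p) (Fin (m + 2) × Fin p) ℂ :=
  selection fun x => (x.1.castSucc, x.2)

/-- The matrix `[I 0 ⋯ 0]`. -/
noncomputable def firstBlockRow (m p : ℕ) : Matrix (Fin p) (Fin (m + 1) × Fin p) ℂ :=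
  selection fun b => (0, b)

theorem dropLast_decomposition (m p : ℕ) :
    (dropLast m p)ᴴ * dropLast m p + (lastBlockRow (m + 1) p)ᴴ * lastBlockRow (m + 1) p = 1 := by
  ext ⟨i, b⟩ ⟨i', b'⟩
  rw [Matrix.add_apply, lastBlockRow_eq_selection, mul_apply, mul_apply, Fintype.sum_prod_type]
  induction i using Fin.lastCases <;> induction i' using Fin.lastCases <;>
    simp [dropLast, selection, one_apply, ite_and, apply_ite, eq_comm]
  split_ifs <;> simp_all

theorem dropLast_mul_lastBlockRow (m p : ℕ) : dropLast m p * (lastBlockRow (m + 1) p)ᴴ = 0 := by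
  rw [lastBlockRow_eq_selection, mul_conjTranspose_selection]
  ext x b
  simp [dropLast, selection, one_apply, (Fin.castSucc_lt_last x.1).ne]

theorem dropLast_toeplitz (a : ℕ → Matrix (Fin p) (Fin p) ℂ) (m : ℕ) :
    dropLast m p * toeplitz a (m + 2) * (dropLast m p)ᴴ = toeplitz a (m + 1) := by
  rw [dropLast, mul_conjTranspose_selection, selection_mul]
  rfl

theorem dropLast_mul_Phi1 (m p : ℕ) : dropLast m p * Phi1 (m + 1) p = Phi1 m p := by
  rw [dropLast, selection_mul]
  rfl

theorem dropLast_mul_Phi2 (a : ℕ → Matrix (Fin p) (Fin p) ℂ) (ν : Matrix (Fin p) (Fin p) ℂ)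
    (m : ℕ) :
    dropLast m p * Phi2 (toeplitz a (m + 2)) ν = Phi2 (toeplitz a (m + 1)) ν := by
  rw [dropLast, selection_mul]
  ext x b
  rw [submatrix_apply, Phi2_toeplitz_apply, Phi2_toeplitz_apply]
  rfl

theorem lastBlockRow_mul_Phi1 (m p : ℕ) : lastBlockRow m p * Phi1 m p = 1 := by
  rw [lastBlockRow_eq_selection, selection_mul]
  rfl

theorem lastBlockRow_mul_Phi2 (a : ℕ → Matrix (Fin p) (Fin p) ℂ) (ν : Matrix (Fin p) (Fin p) ℂ)
    (m : ℕ) : lastBlockRow m p * Phi2 (toeplitz a (m + 1)) ν = phi a ν m := by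
  rw [lastBlockRow_eq_selection, selection_mul]
  ext b b'
  rw [submatrix_apply, Phi2_toeplitz_apply]
  rfl

theorem lowerHalf_mul_firstBlockRow (m p : ℕ) :
    lowerHalf (m + 1) p * (firstBlockRow m p)ᴴ
      = Phi1 m p - (1 / 2 : ℂ) • (firstBlockRow m p)ᴴ := by
  rw [firstBlockRow, mul_conjTranspose_selection]
  ext ⟨i, b⟩ b'
  by_cases h1 : i = 0
  · by_cases h2 : b = b'
    · simp [lowerHalf, selection, one_apply, Phi1, h1, h2]
      norm_num
    · simp [lowerHalf, selection, one_apply, Phi1, h1, h2]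
  · by_cases h2 : b = b' <;>
      simp [lowerHalf, selection, one_apply, Phi1, h1, h2, Fin.pos_iff_ne_zero]

theorem lowerHalf_mul_penultimate (m p : ℕ) :
    lowerHalf (m + 2) p * (lastBlockRow m p * dropLast m p)ᴴ
      = (1 / 2 : ℂ) • (lastBlockRow m p * dropLast m p)ᴴ + (lastBlockRow (m + 1) p)ᴴ := by
  have h : lastBlockRow m p * dropLast m p = selection fun b => ((Fin.last m).castSucc, b) := by
    rw [lastBlockRow_eq_selection, selection_mul]
    rfl
  rw [h, mul_conjTranspose_selection, lastBlockRow_eq_selection]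
  ext ⟨i, b⟩ b'
  induction i using Fin.lastCases with
  | last =>
    by_cases h2 : b = b' <;>
      simp [lowerHalf, selection, one_apply, h2, eq_comm, Fin.castSucc_lt_last,
        (Fin.castSucc_lt_last (Fin.last m)).ne]
  | cast i =>
    have h3 : ¬ Fin.last m < i := (Fin.le_last _).not_gt
    by_cases h1 : i = Fin.last m <;> by_cases h2 : b = b' <;>
      simp [lowerHalf, selection, one_apply, h1, h2, h3]

theorem lastBlockRow_toeplitz_sub {a b : ℕ → Matrix (Fin p) (Fin p) ℂ}
    (h : ∀ k < m + 1, a k = b k) :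
    lastBlockRow (m + 1) p * toeplitz a (m + 2) * (dropLast m p)ᴴ
        - lastBlockRow (m + 1) p * toeplitz b (m + 2) * (dropLast m p)ᴴ
      = (a (m + 1) - b (m + 1)) * firstBlockRow m p := by
  rw [dropLast, mul_conjTranspose_selection, mul_conjTranspose_selection,
    lastBlockRow_eq_selection, selection_mul, selection_mul]
  ext c ⟨i, c'⟩
  have e : ∀ d : ℕ → Matrix (Fin p) (Fin p) ℂ,
      toeplitz d (m + 2) (Fin.last (m + 1), c) (i.castSucc, c') = d (m + 1 - i) c c' := by
    intro d
    have hi : (((i.castSucc : Fin (m + 2)) : ℕ) : ℤ) - ((Fin.last (m + 1) : ℕ) : ℤ)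
        = -((m + 1 - i : ℕ) : ℤ) := by
      rw [Fin.val_castSucc, Fin.val_last]
      omega
    rw [toeplitz, of_apply, hi, coeff_neg_natCast]
  have e' : ((a (m + 1) - b (m + 1)) * firstBlockRow m p) c (i, c')
      = if i = 0 then (a (m + 1) - b (m + 1)) c c' else 0 := by
    by_cases hi : i = 0 <;>
      simp [firstBlockRow, selection, mul_apply, one_apply, hi, eq_comm]
  rw [e', Matrix.sub_apply, submatrix_apply, submatrix_apply, submatrix_apply, submatrix_apply]
  simp only [id]
  rw [e, e]
  split_ifs with hi
  · simp [hi]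
  · rw [h (m + 1 - i), sub_self]
    have : (i : ℕ) ≠ 0 := fun h0 => hi (Fin.ext h0)
    omega

/-- The last row of `S(m+2)⁻¹`, normalized, in terms of the last row of `S(m+2)` and of
`S(m+1)⁻¹`. -/
noncomputable def extensionRow (a : ℕ → Matrix (Fin p) (Fin p) ℂ) (m : ℕ) :
    Matrix (Fin p) (Fin (m + 2) × Fin p) ℂ :=
  lastBlockRow (m + 1) p - lastBlockRow (m + 1) p * toeplitz a (m + 2) * (dropLast m p)ᴴ *
    (toeplitz a (m + 1))⁻¹ * dropLast m p

/-- The Schur complement of `S(m+1)` in `S(m+2)`. -/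
noncomputable def schurComplement (a : ℕ → Matrix (Fin p) (Fin p) ℂ) (m : ℕ) :
    Matrix (Fin p) (Fin p) ℂ :=
  extensionRow a m * toeplitz a (m + 2) * (lastBlockRow (m + 1) p)ᴴ

theorem extensionRow_mul_lastBlockRow (a : ℕ → Matrix (Fin p) (Fin p) ℂ) (m : ℕ) :
    extensionRow a m * (lastBlockRow (m + 1) p)ᴴ = 1 := by
  rw [extensionRow, Matrix.sub_mul, lastBlockRow_mul_conjTranspose, Matrix.mul_assoc _ (dropLast m p),
    dropLast_mul_lastBlockRow, Matrix.mul_zero, sub_zero]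

theorem eq_mul_lastBlockRow {k : Type*} {M : Matrix k (Fin (m + 2) × Fin p) ℂ}
    (h : M * (dropLast m p)ᴴ = 0) :
    M = M * (lastBlockRow (m + 1) p)ᴴ * lastBlockRow (m + 1) p := by
  conv_lhs => rw [← Matrix.mul_one M, ← dropLast_decomposition, Matrix.mul_add, ← Matrix.mul_assoc,
    h, Matrix.zero_mul, zero_add, ← Matrix.mul_assoc]

theorem extensionRow_mul_toeplitz {a : ℕ → Matrix (Fin p) (Fin p) ℂ}
    (hS : (toeplitz a (m + 1)).PosDef) :
    extensionRow a m * toeplitz a (m + 2) = schurComplement a m * lastBlockRow (m + 1) p := by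
  refine eq_mul_lastBlockRow ?_
  have h := dropLast_toeplitz a m
  rw [extensionRow, Matrix.sub_mul, Matrix.sub_mul]
  simp only [Matrix.mul_assoc] at h ⊢
  rw [h, nonsing_inv_mul _ ((isUnit_iff_isUnit_det _).1 hS.isUnit), Matrix.mul_one, sub_self]

theorem eq_zero_of_mul_toeplitz_eq_zero {k : Type*} {a : ℕ → Matrix (Fin p) (Fin p) ℂ}
    (hS : (toeplitz a (m + 1)).PosDef) {h : Matrix k (Fin (m + 2) × Fin p) ℂ}
    (h0 : h * toeplitz a (m + 2) = 0) (he : h * (lastBlockRow (m + 1) p)ᴴ = 0) : h = 0 := by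
  have hh : h = h * (dropLast m p)ᴴ * dropLast m p := by
    conv_lhs => rw [← Matrix.mul_one h, ← dropLast_decomposition, Matrix.mul_add, ← Matrix.mul_assoc,
      ← Matrix.mul_assoc, he, Matrix.zero_mul, add_zero]
  have hZS : h * (dropLast m p)ᴴ * toeplitz a (m + 1) = 0 := by
    have h5 : h * (dropLast m p)ᴴ * (dropLast m p * toeplitz a (m + 2) * (dropLast m p)ᴴ)
        = h * (dropLast m p)ᴴ * dropLast m p * toeplitz a (m + 2) * (dropLast m p)ᴴ := by
      simp only [Matrix.mul_assoc]
    rw [← dropLast_toeplitz, h5, ← hh, h0, Matrix.zero_mul]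
  rw [hh, ← mul_nonsing_inv_cancel_right _ (h * (dropLast m p)ᴴ)
    ((isUnit_iff_isUnit_det _).1 hS.isUnit), hZS, Matrix.zero_mul, Matrix.zero_mul]

theorem posDef_toeplitz_succ {a : ℕ → Matrix (Fin p) (Fin p) ℂ}
    (hS : (toeplitz a (m + 1)).PosDef) (hq : (schurComplement a m).PosDef) :
    (toeplitz a (m + 2)).PosDef := by
  have ha := isHermitian_of_isHermitian_toeplitz (by omega) hS.isHermitian
  have hT := isHermitian_toeplitz ha (m + 2)
  have hw := extensionRow_mul_toeplitz hS
  have hw1 := extensionRow_mul_lastBlockRow a m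
  have hdec := dropLast_decomposition m p
  have hed := dropLast_mul_lastBlockRow m p
  have hdrop := dropLast_toeplitz a m
  obtain ⟨c, hc⟩ : ∃ c, extensionRow a m = lastBlockRow (m + 1) p - c * dropLast m p := ⟨_, rfl⟩
  set w := extensionRow a m
  set e := lastBlockRow (m + 1) p
  set E := dropLast m p
  set T := toeplitz a (m + 2)
  set q := schurComplement a m
  have h1 : Eᴴ * (E + cᴴ * e) + wᴴ * e = 1 := by
    rw [← hdec, hc, conjTranspose_sub, conjTranspose_mul, Matrix.mul_add, Matrix.sub_mul,
      Matrix.mul_assoc Eᴴ]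
    abel
  have hde : e * Eᴴ = 0 := by
    rw [← conjTranspose_conjTranspose (e * Eᴴ), conjTranspose_mul, conjTranspose_conjTranspose, hed,
      conjTranspose_zero]
  have hew : e * wᴴ = 1 := by
    rw [← conjTranspose_conjTranspose (e * wᴴ), conjTranspose_mul, conjTranspose_conjTranspose, hw1,
      conjTranspose_one]
  have hwE : w * T * Eᴴ = 0 := by rw [hw, Matrix.mul_assoc, hde, Matrix.mul_zero]
  have hEw : E * T * wᴴ = 0 := by
    have := congrArg conjTranspose hwE
    simpa [conjTranspose_mul, hT.eq, Matrix.mul_assoc] using this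
  have hwT : w * T * wᴴ = q := by rw [hw, Matrix.mul_assoc, hew, Matrix.mul_one]
  obtain ⟨G, hG⟩ : ∃ G, G = E + cᴴ * e := ⟨_, rfl⟩
  rw [← hG] at h1
  -- The block factorization of `T` by its Schur complement. It shows only semidefiniteness;
  -- invertibility is checked separately.
  have h2 : T = Gᴴ * toeplitz a (m + 1) * G + eᴴ * q * e := by
    have h3 : T = (Eᴴ * G + wᴴ * e)ᴴ * T * (Eᴴ * G + wᴴ * e) := by
      rw [h1, conjTranspose_one, Matrix.one_mul, Matrix.mul_one]
    have h4 : (Eᴴ * G + wᴴ * e)ᴴ * T * (Eᴴ * G + wᴴ * e)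
        = Gᴴ * (E * T * Eᴴ) * G + Gᴴ * (E * T * wᴴ) * e
          + (eᴴ * (w * T * Eᴴ) * G + eᴴ * (w * T * wᴴ) * e) := by
      simp only [conjTranspose_add, conjTranspose_mul, conjTranspose_conjTranspose, Matrix.add_mul,
        Matrix.mul_add, Matrix.mul_assoc]
      abel
    rw [h3, h4, hdrop, hEw, hwE, hwT]
    simp
  have hpsd : T.PosSemidef := by
    rw [h2]
    exact (hS.posSemidef.conjTranspose_mul_mul_same G).add
      (hq.posSemidef.conjTranspose_mul_mul_same e)
  refine hpsd.posDef_iff_isUnit.2 (isUnit_of_forall_mul_eq_zero fun Z hZ => ?_)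
  have hZw : Z * T * wᴴ = 0 := by rw [hZ, Matrix.zero_mul]
  have hTw : T * wᴴ = eᴴ * q := by
    have := congrArg conjTranspose hw
    simpa [conjTranspose_mul, hT.eq, hq.isHermitian.eq] using this
  have hZe : Z * eᴴ = 0 := by
    rw [Matrix.mul_assoc, hTw, ← Matrix.mul_assoc] at hZw
    rw [← mul_nonsing_inv_cancel_right _ (Z * eᴴ) ((isUnit_iff_isUnit_det _).1 hq.isUnit), hZw,
      Matrix.zero_mul]
  exact eq_zero_of_mul_toeplitz_eq_zero hS hZ hZe

/-- If `Z P = 0`, then also `Z R = 0` and `Z q = 0`, so `Z w` annihilates `Φ₁`, `Φ₂` and `T`. By the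
displacement identity it annihilates `L T` too, and the triangular shape of `L` then forces `Z = 0`.
-/
theorem isUnit_plusPart_of_minusPart_eq {a : ℕ → Matrix (Fin p) (Fin p) ℂ}
    (hS : (toeplitz a (m + 1)).PosDef) {ν r : Matrix (Fin p) (Fin p) ℂ} (hν : ν.IsHermitian)
    (h : minusPart (extensionRow a m) (toeplitz a (m + 2)) ν
      = plusPart (extensionRow a m) (toeplitz a (m + 2)) ν * r) :
    IsUnit (plusPart (extensionRow a m) (toeplitz a (m + 2)) ν) := by
  have ha := isHermitian_of_isHermitian_toeplitz (by omega) hS.isHermitian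
  have hw := extensionRow_mul_toeplitz hS
  have hw1 := extensionRow_mul_lastBlockRow a m
  have key := plusPart_mul_conjTranspose ha hν hw hw1
  have hid := lowerHalf_mul_toeplitz_add ha hν (m + 1)
  have hlast := lowerHalf_mul_lastBlockRow (p := p) (m + 1)
  have hpen := lowerHalf_mul_penultimate m p
  refine isUnit_of_forall_mul_eq_zero fun Z hZ => ?_
  have hZ' : Z * minusPart (extensionRow a m) (toeplitz a (m + 2)) ν = 0 := by
    rw [h, ← mul_assoc, hZ, zero_mul]
  have hZq : Z * schurComplement a m = 0 := by
    have h1 := congrArg (Z * ·) key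
    simp only [mul_add, ← mul_assoc, hZ, hZ', zero_mul, zero_add, mul_smul_comm] at h1
    exact (smul_eq_zero_iff_right (two_ne_zero (α := ℂ))).1 h1.symm
  set w := extensionRow a m
  set e := lastBlockRow (m + 1) p
  set T := toeplitz a (m + 2)
  set L := lowerHalf (m + 2) p
  rw [plusPart, Matrix.mul_add, Matrix.mul_add] at hZ
  rw [minusPart, Matrix.mul_sub, Matrix.mul_sub] at hZ'
  have hΦ2 : Z * w * Phi2 T ν = 0 := by
    rw [Matrix.mul_assoc]
    have h1 : (2 : ℂ) • (Z * (w * Phi2 T ν)) = 0 := by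
      rw [← add_zero (0 : Matrix (Fin p) (Fin p) ℂ)]
      nth_rw 1 [← hZ]
      rw [← hZ']
      module
    exact (smul_eq_zero_iff_right (two_ne_zero (α := ℂ))).1 h1
  have hΦ1 : Z * w * Phi1 (m + 1) p = 0 := by
    rw [Matrix.mul_assoc] at hΦ2 ⊢
    rwa [hΦ2, zero_add] at hZ
  have hZT : Z * w * T = 0 := by rw [Matrix.mul_assoc, hw, ← Matrix.mul_assoc, hZq, Matrix.zero_mul]
  have hLT : Z * w * (L * T) = 0 := by
    have h1 := congrArg (Z * w * ·) hid
    simp only [Matrix.mul_add, ← Matrix.mul_assoc, hΦ1, hΦ2, hZT, Matrix.zero_mul, add_zero] at h1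
    rw [← h1, Matrix.mul_assoc (Z * w)]
  have hzero : Z * w * L - (1 / 2 : ℂ) • (Z * w) = 0 := by
    refine eq_zero_of_mul_toeplitz_eq_zero hS ?_ ?_
    · rw [Matrix.sub_mul, Matrix.smul_mul, hZT, Matrix.mul_assoc (Z * w), hLT, smul_zero, sub_zero]
    · rw [Matrix.sub_mul, Matrix.mul_assoc (Z * w), hlast, Matrix.mul_smul, Matrix.smul_mul, sub_self]
  -- The penultimate block of `Z w (L - 1/2)` is the last block of `Z w`, which is `Z`.
  have h1 : Z * w * (L * (lastBlockRow m p * dropLast m p)ᴴ)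
      - (1 / 2 : ℂ) • (Z * w * (lastBlockRow m p * dropLast m p)ᴴ) = 0 := by
    rw [← Matrix.mul_assoc, ← Matrix.smul_mul, ← Matrix.sub_mul, hzero, Matrix.zero_mul]
  rwa [hpen, Matrix.mul_add, Matrix.mul_smul, add_sub_cancel_left, Matrix.mul_assoc, hw1,
    Matrix.mul_one] at h1

/-- The coefficient of `s_{-(m+1)}` in `w (Φ₂ + Φ₁)`. -/
noncomputable def plusSlope (S : Matrix (Fin (m + 1) × Fin p) (Fin (m + 1) × Fin p) ℂ)
    (ν : Matrix (Fin p) (Fin p) ℂ) : Matrix (Fin p) (Fin p) ℂ :=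
  1 - firstBlockRow m p * S⁻¹ * (Phi2 S ν + Phi1 m p)

/-- The coefficient of `s_{-(m+1)}` in `w (Φ₂ - Φ₁)`. -/
noncomputable def minusSlope (S : Matrix (Fin (m + 1) × Fin p) (Fin (m + 1) × Fin p) ℂ)
    (ν : Matrix (Fin p) (Fin p) ℂ) : Matrix (Fin p) (Fin p) ℂ :=
  1 - firstBlockRow m p * S⁻¹ * (Phi2 S ν - Phi1 m p)

/-- Compress the displacement identity by `h = f S⁻¹`, with `f` the first block row selector, and
use `L f* = Φ₁ - f* / 2`. Here the minus part dominates, opposite to `plusPart_mul_conjTranspose`.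
-/
theorem minusSlope_mul_conjTranspose {a : ℕ → Matrix (Fin p) (Fin p) ℂ}
    (hS : (toeplitz a (m + 1)).PosDef) {ν : Matrix (Fin p) (Fin p) ℂ} (hν : ν.IsHermitian) :
    minusSlope (toeplitz a (m + 1)) ν * (minusSlope (toeplitz a (m + 1)) ν)ᴴ
      = plusSlope (toeplitz a (m + 1)) ν * (plusSlope (toeplitz a (m + 1)) ν)ᴴ
        + (2 : ℂ) • (firstBlockRow m p * (toeplitz a (m + 1))⁻¹ * (firstBlockRow m p)ᴴ) := by
  have ha := isHermitian_of_isHermitian_toeplitz (by omega) hS.isHermitian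
  have hid := lowerHalf_mul_toeplitz_add ha hν m
  have hfirst := lowerHalf_mul_firstBlockRow m p
  set T := toeplitz a (m + 1)
  have hdet := (isUnit_iff_isUnit_det _).1 hS.isUnit
  have hinv : (T⁻¹)ᴴ = T⁻¹ := hS.inv.isHermitian
  set f := firstBlockRow m p
  set L := lowerHalf (m + 1) p
  obtain ⟨h, hh⟩ : ∃ h, h = f * T⁻¹ := ⟨_, rfl⟩
  have hhT : h * T = f := by rw [hh, nonsing_inv_mul_cancel_right _ _ hdet]
  have hTh : T * hᴴ = fᴴ := by
    have := congrArg conjTranspose hhT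
    rwa [conjTranspose_mul, hS.isHermitian.eq] at this
  have hfh : f * hᴴ = h * fᴴ := by rw [hh, conjTranspose_mul, hinv, Matrix.mul_assoc]
  have h1 : h * (L * T) * hᴴ = h * Phi1 m p - (1 / 2 : ℂ) • (h * fᴴ) := by
    rw [Matrix.mul_assoc, Matrix.mul_assoc, hTh, hfirst, Matrix.mul_sub, Matrix.mul_smul]
  have h2 : h * (T * Lᴴ) * hᴴ = (Phi1 m p)ᴴ * hᴴ - (1 / 2 : ℂ) • (h * fᴴ) := by
    have := congrArg conjTranspose h1
    simpa [conjTranspose_mul, conjTranspose_sub, conjTranspose_smul, hS.isHermitian.eq, hfh,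
      Matrix.mul_assoc] using this
  have h3 : h * (Phi1 m p * (Phi2 T ν)ᴴ + Phi2 T ν * (Phi1 m p)ᴴ) * hᴴ
      = h * Phi1 m p + (Phi1 m p)ᴴ * hᴴ - h * fᴴ := by
    rw [← hid, Matrix.mul_add, Matrix.add_mul, h1, h2]
    module
  have h4 : minusSlope T ν * (minusSlope T ν)ᴴ - plusSlope T ν * (plusSlope T ν)ᴴ
      = (2 : ℂ) • (h * Phi1 m p + (Phi1 m p)ᴴ * hᴴ
        - h * (Phi1 m p * (Phi2 T ν)ᴴ + Phi2 T ν * (Phi1 m p)ᴴ) * hᴴ) := by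
    rw [minusSlope, plusSlope, ← hh]
    simp only [conjTranspose_mul, conjTranspose_add, conjTranspose_sub, conjTranspose_one,
      Matrix.mul_add, Matrix.add_mul, Matrix.mul_sub, Matrix.sub_mul, Matrix.mul_assoc,
      Matrix.one_mul, Matrix.mul_one]
    module
  rw [h3, sub_sub_cancel] at h4
  rw [← hh, ← h4]
  abel

theorem posDef_firstBlock_inv {S : Matrix (Fin (m + 1) × Fin p) (Fin (m + 1) × Fin p) ℂ}
    (hS : S.PosDef) : (firstBlockRow m p * S⁻¹ * (firstBlockRow m p)ᴴ).PosDef := by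
  rw [firstBlockRow, mul_conjTranspose_selection, selection_mul]
  exact hS.inv.submatrix fun _ _ h => (Prod.ext_iff.1 h).2

theorem isUnit_minusSlope_sub {a : ℕ → Matrix (Fin p) (Fin p) ℂ}
    (hS : (toeplitz a (m + 1)).PosDef) {ν r : Matrix (Fin p) (Fin p) ℂ} (hν : ν.IsHermitian)
    (hr : ‖r‖ < 1) :
    IsUnit (minusSlope (toeplitz a (m + 1)) ν - plusSlope (toeplitz a (m + 1)) ν * r) :=
  isUnit_sub_mul ((posDef_firstBlock_inv hS).smul two_pos) (minusSlope_mul_conjTranspose hS hν) hr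

theorem phi_succ_sub {a b : ℕ → Matrix (Fin p) (Fin p) ℂ} (ν : Matrix (Fin p) (Fin p) ℂ)
    (h : ∀ k < m + 1, a k = b k) :
    phi a ν (m + 1) - phi b ν (m + 1) = a (m + 1) - b (m + 1) := by
  have h1 : ∑ l ∈ Finset.range m, a (l + 1) = ∑ l ∈ Finset.range m, b (l + 1) :=
    Finset.sum_congr rfl fun l hl => h _ (Nat.succ_lt_succ (Finset.mem_range.1 hl))
  rw [phi, phi, Finset.sum_range_succ, Finset.sum_range_succ, h1, h 0 (Nat.succ_pos _)]
  abel

theorem extensionRow_mul_eq (a : ℕ → Matrix (Fin p) (Fin p) ℂ) (m : ℕ) {k : Type*}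
    (M : Matrix (Fin (m + 2) × Fin p) k ℂ) :
    extensionRow a m * M = lastBlockRow (m + 1) p * M
      - lastBlockRow (m + 1) p * toeplitz a (m + 2) * (dropLast m p)ᴴ *
        ((toeplitz a (m + 1))⁻¹ * (dropLast m p * M)) := by
  rw [extensionRow, Matrix.sub_mul]
  simp only [Matrix.mul_assoc]

/-- The new coefficient enters twice: in the last block of `Φ₂`, giving the 1 of the slope, and in
the first block of the last row of the Toeplitz matrix, giving the term with `S⁻¹`. -/
theorem plusPart_extensionRow_sub {a b : ℕ → Matrix (Fin p) (Fin p) ℂ}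
    (ν : Matrix (Fin p) (Fin p) ℂ) (h : ∀ k < m + 1, a k = b k) :
    plusPart (extensionRow a m) (toeplitz a (m + 2)) ν
        - plusPart (extensionRow b m) (toeplitz b (m + 2)) ν
      = (a (m + 1) - b (m + 1)) * plusSlope (toeplitz a (m + 1)) ν := by
  have h1 := lastBlockRow_toeplitz_sub h
  have h2 := phi_succ_sub ν h
  rw [plusPart, plusPart, extensionRow_mul_eq, extensionRow_mul_eq]
  simp only [Matrix.mul_add _ (Phi2 _ _), dropLast_mul_Phi1, dropLast_mul_Phi2,
    lastBlockRow_mul_Phi1, lastBlockRow_mul_Phi2]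
  rw [← toeplitz_congr h, sub_sub_sub_comm, ← Matrix.sub_mul, h1, add_sub_add_right_eq_sub, h2,
    plusSlope, Matrix.mul_sub (a (m + 1) - b (m + 1)) 1, Matrix.mul_one]
  simp only [Matrix.mul_add, Matrix.mul_assoc]

theorem minusPart_extensionRow_sub {a b : ℕ → Matrix (Fin p) (Fin p) ℂ}
    (ν : Matrix (Fin p) (Fin p) ℂ) (h : ∀ k < m + 1, a k = b k) :
    minusPart (extensionRow a m) (toeplitz a (m + 2)) ν
        - minusPart (extensionRow b m) (toeplitz b (m + 2)) ν
      = (a (m + 1) - b (m + 1)) * minusSlope (toeplitz a (m + 1)) ν := by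
  have h1 := lastBlockRow_toeplitz_sub h
  have h2 := phi_succ_sub ν h
  rw [minusPart, minusPart, extensionRow_mul_eq, extensionRow_mul_eq]
  simp only [Matrix.mul_sub _ (Phi2 _ _), dropLast_mul_Phi1, dropLast_mul_Phi2,
    lastBlockRow_mul_Phi1, lastBlockRow_mul_Phi2]
  rw [← toeplitz_congr h, sub_sub_sub_comm, ← Matrix.sub_mul, h1, sub_sub_sub_cancel_right, h2,
    minusSlope, Matrix.mul_sub (a (m + 1) - b (m + 1)) 1, Matrix.mul_one]
  simp only [Matrix.mul_sub, Matrix.mul_assoc]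

end Extension

/-! ### Pairs correspond to sequences of strict contractions. -/

section Bijection

variable {p m : ℕ}

theorem norm_cayley_lt_one {a : ℕ → Matrix (Fin p) (Fin p) ℂ} (hS : (toeplitz a (m + 1)).PosDef)
    {ν : Matrix (Fin p) (Fin p) ℂ} (hν : ν.IsHermitian) :
    ‖cayley (toeplitz a (m + 1)) ν‖ < 1 :=
  (verblunsky_spec hS hν (Fin.last m)).2.1

theorem cayley_eq_iff {a : ℕ → Matrix (Fin p) (Fin p) ℂ} (hS : (toeplitz a (m + 1)).PosDef)
    {ν r : Matrix (Fin p) (Fin p) ℂ} (hν : ν.IsHermitian)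
    {w : Matrix (Fin p) (Fin (m + 1) × Fin p) ℂ} {q : Matrix (Fin p) (Fin p) ℂ}
    (hw : w * toeplitz a (m + 1) = q * lastBlockRow m p) (hw1 : w * (lastBlockRow m p)ᴴ = 1) :
    cayley (toeplitz a (m + 1)) ν = r ↔
      minusPart w (toeplitz a (m + 1)) ν = plusPart w (toeplitz a (m + 1)) ν * r := by
  have ha := isHermitian_of_isHermitian_toeplitz (by omega) hS.isHermitian
  have key := plusPart_mul_conjTranspose ha hν (normalizedLastRow_mul hS)
    (normalizedLastRow_mul_lastBlockRow hS)
  have hdet := (isUnit_iff_isUnit_det _).1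
    (isUnit_of_mul_conjTranspose_eq ((posDef_t hS).inv.smul two_pos) key)
  rw [eq_normalizedLastRow hS hw hw1, cayley]
  constructor
  · rintro rfl
    rw [mul_nonsing_inv_cancel_left _ _ hdet]
  · intro h
    rw [h, nonsing_inv_mul_cancel_left _ _ hdet]

theorem cayley_succ_eq_iff {a : ℕ → Matrix (Fin p) (Fin p) ℂ} (hS : (toeplitz a (m + 2)).PosDef)
    {ν r : Matrix (Fin p) (Fin p) ℂ} (hν : ν.IsHermitian) :
    cayley (toeplitz a (m + 2)) ν = r ↔
      minusPart (extensionRow a m) (toeplitz a (m + 2)) ν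
        = plusPart (extensionRow a m) (toeplitz a (m + 2)) ν * r :=
  cayley_eq_iff hS hν (extensionRow_mul_toeplitz (posDef_toeplitz_of_le (by omega) hS))
    (extensionRow_mul_lastBlockRow a m)

theorem lastBlockRow_mul_toeplitz_one (a : ℕ → Matrix (Fin p) (Fin p) ℂ) :
    lastBlockRow 0 p * toeplitz a 1 = a 0 * lastBlockRow 0 p := by
  rw [lastBlockRow_eq_selection, selection_mul]
  ext b ⟨i, c⟩
  obtain rfl := Subsingleton.elim i 0
  simp [toeplitz, selection, mul_apply, one_apply, coeff_zero]

theorem plusPart_zero (a : ℕ → Matrix (Fin p) (Fin p) ℂ) (ν : Matrix (Fin p) (Fin p) ℂ) :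
    plusPart (lastBlockRow 0 p) (toeplitz a 1) ν = phi a ν 0 + 1 := by
  rw [plusPart, Matrix.mul_add, lastBlockRow_mul_Phi2, lastBlockRow_mul_Phi1]

theorem minusPart_zero (a : ℕ → Matrix (Fin p) (Fin p) ℂ) (ν : Matrix (Fin p) (Fin p) ℂ) :
    minusPart (lastBlockRow 0 p) (toeplitz a 1) ν = phi a ν 0 - 1 := by
  rw [minusPart, Matrix.mul_sub, lastBlockRow_mul_Phi2, lastBlockRow_mul_Phi1]

theorem cayley_one_eq_iff {a : ℕ → Matrix (Fin p) (Fin p) ℂ} (hS : (toeplitz a 1).PosDef)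
    {ν r : Matrix (Fin p) (Fin p) ℂ} (hν : ν.IsHermitian) :
    cayley (toeplitz a 1) ν = r ↔ phi a ν 0 * (1 - r) = 1 + r := by
  rw [cayley_eq_iff hS hν (lastBlockRow_mul_toeplitz_one a) (lastBlockRow_mul_conjTranspose 0 p),
    plusPart_zero, minusPart_zero, ← sub_eq_zero, ← sub_eq_zero (a := phi a ν 0 * _)]
  have h : phi a ν 0 - 1 - (phi a ν 0 + 1) * r = phi a ν 0 * (1 - r) - (1 + r) := by
    rw [add_mul, one_mul, mul_sub, mul_one]
    abel
  rw [h]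

theorem phi_zero_add_conjTranspose {a : ℕ → Matrix (Fin p) (Fin p) ℂ} (ha : (a 0).IsHermitian)
    {ν : Matrix (Fin p) (Fin p) ℂ} (hν : ν.IsHermitian) : phi a ν 0 + (phi a ν 0)ᴴ = a 0 := by
  have hI : star Complex.I = -Complex.I := by simp
  have h2 : star (1 / 2 : ℂ) = 1 / 2 := by simp
  simp only [phi, Finset.range_zero, Finset.sum_empty, add_zero, conjTranspose_add,
    conjTranspose_smul, ha.eq, hν.eq, hI, h2]
  module

theorem phi_zero_injective {a b : ℕ → Matrix (Fin p) (Fin p) ℂ} (ha : (a 0).IsHermitian)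
    (hb : (b 0).IsHermitian) {ν μ : Matrix (Fin p) (Fin p) ℂ} (hν : ν.IsHermitian)
    (hμ : μ.IsHermitian) (h : phi a ν 0 = phi b μ 0) : a 0 = b 0 ∧ ν = μ := by
  have h0 : a 0 = b 0 := by
    rw [← phi_zero_add_conjTranspose ha hν, h, phi_zero_add_conjTranspose hb hμ]
  refine ⟨h0, ?_⟩
  rw [phi, phi, h0] at h
  exact smul_right_injective _ Complex.I_ne_zero (add_left_cancel h)

theorem cayley_injective {a b : ℕ → Matrix (Fin p) (Fin p) ℂ} {ν μ : Matrix (Fin p) (Fin p) ℂ}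
    (hν : ν.IsHermitian) (hμ : μ.IsHermitian) (m : ℕ) (hSa : (toeplitz a (m + 1)).PosDef)
    (hSb : (toeplitz b (m + 1)).PosDef)
    (h : ∀ k ≤ m, cayley (toeplitz a (k + 1)) ν = cayley (toeplitz b (k + 1)) μ) :
    (∀ k < m + 1, a k = b k) ∧ ν = μ := by
  induction m with
  | zero =>
    have ha := isHermitian_of_isHermitian_toeplitz (by omega) hSa.isHermitian
    have hb := isHermitian_of_isHermitian_toeplitz (by omega) hSb.isHermitian
    have e1 := (cayley_one_eq_iff hSa hν).1 (h 0 le_rfl)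
    have e2 := (cayley_one_eq_iff hSb hμ).1 rfl
    have hU := isUnit_one_sub_of_norm_lt_one (norm_cayley_lt_one hSb hμ)
    have h1 := phi_zero_injective ha hb hν hμ (hU.mul_right_cancel (e1.trans e2.symm))
    refine ⟨fun k hk => ?_, h1.2⟩
    rw [Nat.lt_one_iff.1 hk]
    exact h1.1
  | succ m ih =>
    have hSa' : (toeplitz a (m + 1)).PosDef := posDef_toeplitz_of_le (by omega) hSa
    obtain ⟨hab, rfl⟩ := ih hSa' (posDef_toeplitz_of_le (by omega) hSb)
      fun k hk => h k (hk.trans (Nat.le_succ m))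
    refine ⟨fun k hk => ?_, rfl⟩
    rcases Nat.lt_succ_iff_lt_or_eq.1 hk with hk | rfl
    · exact hab k hk
    have e1 := (cayley_succ_eq_iff hSa hν).1 (h (m + 1) le_rfl)
    have e2 := (cayley_succ_eq_iff hSb hν).1 rfl
    have hU := isUnit_minusSlope_sub hSa' hν (norm_cayley_lt_one hSb hν)
    have h1 := minusPart_extensionRow_sub ν hab
    -- Subtracting the two equations `R = P r` leaves `(a_{m+1} - b_{m+1}) (B - A r) = 0` with an
    -- invertible right factor.
    rw [e1, e2, ← sub_mul, plusPart_extensionRow_sub ν hab, mul_assoc] at h1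
    rw [← sub_eq_zero]
    refine hU.mul_right_cancel ?_
    rw [mul_sub, ← h1, sub_self, zero_mul]

theorem exists_phi_zero_eq {c : Matrix (Fin p) (Fin p) ℂ} :
    ∃ (a : ℕ → Matrix (Fin p) (Fin p) ℂ) (ν : Matrix (Fin p) (Fin p) ℂ),
      (a 0).IsHermitian ∧ ν.IsHermitian ∧ phi a ν 0 = c := by
  have hI : star Complex.I = -Complex.I := by simp
  have h2 : star (1 / 2 : ℂ) = 1 / 2 := by simp
  -- The real and imaginary parts of `c`; only the term `a 0` matters.
  refine ⟨fun _ => c + cᴴ, (-Complex.I * (1 / 2)) • (c - cᴴ), ?_, ?_, ?_⟩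
  · rw [IsHermitian, conjTranspose_add, conjTranspose_conjTranspose, add_comm]
  · rw [IsHermitian, conjTranspose_smul, conjTranspose_sub, conjTranspose_conjTranspose, star_mul',
      star_neg, hI, h2]
    module
  · have h3 : Complex.I * (-Complex.I * (1 / 2)) = 1 / 2 := by
      linear_combination (-1 / 2 : ℂ) * Complex.I_mul_I
    simp only [phi, Finset.range_zero, Finset.sum_empty, add_zero, smul_smul, h3]
    module

theorem posDef_of_two_smul {q : Matrix (Fin p) (Fin p) ℂ} (h : ((2 : ℂ) • q).PosDef) :
    q.PosDef := by
  have h1 := h.smul (inv_pos.2 (two_pos (α := ℂ)))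
  rwa [smul_smul, inv_mul_cancel₀ two_ne_zero, one_smul] at h1

theorem posDef_of_mul_conjTranspose_eq {P R q r : Matrix (Fin p) (Fin p) ℂ}
    (h : P * Pᴴ = R * Rᴴ + (2 : ℂ) • q) (hR : R = P * r) (hr : ‖r‖ < 1) (hP : IsUnit P) :
    q.PosDef := by
  refine posDef_of_two_smul ?_
  have h1 : (2 : ℂ) • q = P * (1 - r * rᴴ) * Pᴴ := by
    rw [← add_sub_cancel_left (R * Rᴴ) ((2 : ℂ) • q), ← h, hR, conjTranspose_mul]
    simp only [Matrix.sub_mul, Matrix.mul_sub, Matrix.mul_assoc, Matrix.one_mul]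
  rw [h1]
  exact ((norm_lt_one_iff_posDef r).1 hr).conjugate hP

theorem posDef_toeplitz_one {a : ℕ → Matrix (Fin p) (Fin p) ℂ} (h : (a 0).PosDef) :
    (toeplitz a 1).PosDef := by
  have h1 : toeplitz a 1 = (a 0).submatrix Prod.snd Prod.snd := by
    ext ⟨i, b⟩ ⟨i', b'⟩
    simp [toeplitz, coeff_zero]
  rw [h1]
  exact h.submatrix fun x y hxy => Prod.ext (Subsingleton.elim _ _) hxy

theorem exists_cayley_eq {r : ℕ → Matrix (Fin p) (Fin p) ℂ} (hr : ∀ k, ‖r k‖ < 1) (m : ℕ) :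
    ∃ (a : ℕ → Matrix (Fin p) (Fin p) ℂ) (ν : Matrix (Fin p) (Fin p) ℂ), ν.IsHermitian ∧
      (toeplitz a (m + 1)).PosDef ∧ ∀ k ≤ m, cayley (toeplitz a (k + 1)) ν = r k := by
  induction m with
  | zero =>
    have hU := isUnit_one_sub_of_norm_lt_one (hr 0)
    have hdet := (isUnit_iff_isUnit_det _).1 hU
    obtain ⟨a, ν, ha, hν, hc⟩ := exists_phi_zero_eq (c := (1 + r 0) * (1 - r 0)⁻¹)
    have hc1 : phi a ν 0 * (1 - r 0) = 1 + r 0 := by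
      rw [hc, nonsing_inv_mul_cancel_right _ _ hdet]
    have key := plusPart_mul_conjTranspose ha hν (lastBlockRow_mul_toeplitz_one a)
      (lastBlockRow_mul_conjTranspose 0 p)
    rw [plusPart_zero, minusPart_zero] at key
    have hP : IsUnit (phi a ν 0 + 1) := by
      have h1 : (phi a ν 0 + 1) * (1 - r 0) = (2 : ℂ) • 1 := by
        rw [add_mul, hc1, one_mul, two_smul]
        abel
      have h2 : (phi a ν 0 + 1) * ((2 : ℂ)⁻¹ • (1 - r 0)) = 1 := by
        rw [mul_smul_comm, h1, smul_smul, inv_mul_cancel₀ two_ne_zero, one_smul]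
      exact IsUnit.of_mul_eq_one _ h2
    have hR : phi a ν 0 - 1 = (phi a ν 0 + 1) * r 0 := by
      rw [mul_sub, mul_one, sub_eq_iff_eq_add] at hc1
      rw [add_mul, one_mul, sub_eq_iff_eq_add]
      nth_rw 1 [hc1]
      abel
    have hS : (toeplitz a 1).PosDef :=
      posDef_toeplitz_one (posDef_of_mul_conjTranspose_eq key hR (hr 0) hP)
    refine ⟨a, ν, hν, hS, fun k hk => ?_⟩
    obtain rfl := Nat.le_zero.1 hk
    exact (cayley_one_eq_iff hS hν).2 hc1
  | succ m ih =>
    obtain ⟨b, ν, hν, hSb, hb⟩ := ih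
    have hU := isUnit_minusSlope_sub hSb hν (hr (m + 1))
    have hdet := (isUnit_iff_isUnit_det _).1 hU
    set D := minusSlope (toeplitz b (m + 1)) ν - plusSlope (toeplitz b (m + 1)) ν * r (m + 1) with hD
    -- The coefficient `b (m + 1)` is an arbitrary starting value; `δ` is the correction that makes
    -- `R = P r` hold for the affine functions `R` and `P`.
    obtain ⟨δ, hδ⟩ : ∃ δ, δ * D = plusPart (extensionRow b m) (toeplitz b (m + 2)) ν * r (m + 1)
        - minusPart (extensionRow b m) (toeplitz b (m + 2)) ν :=
      ⟨_, nonsing_inv_mul_cancel_right _ _ hdet⟩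
    obtain ⟨a, hab, ha1⟩ : ∃ a : ℕ → Matrix (Fin p) (Fin p) ℂ,
        (∀ k < m + 1, a k = b k) ∧ a (m + 1) = b (m + 1) + δ :=
      ⟨Function.update b (m + 1) (b (m + 1) + δ),
        fun k hk => Function.update_of_ne hk.ne _ _, Function.update_self _ _ _⟩
    have hT : ∀ k ≤ m + 1, toeplitz a k = toeplitz b k := fun k hk =>
      toeplitz_congr fun l hl => hab l (hl.trans_le hk)
    have hS : (toeplitz a (m + 1)).PosDef := by rw [hT _ le_rfl]; exact hSb
    have hp := plusPart_extensionRow_sub ν hab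
    have hm := minusPart_extensionRow_sub ν hab
    rw [hT _ le_rfl, ha1, add_sub_cancel_left, sub_eq_iff_eq_add] at hp hm
    have hR : minusPart (extensionRow a m) (toeplitz a (m + 2)) ν
        = plusPart (extensionRow a m) (toeplitz a (m + 2)) ν * r (m + 1) := by
      rw [hD, mul_sub, sub_eq_iff_eq_add] at hδ
      rw [hp, hm, hδ, add_mul, mul_assoc]
      abel
    have hP := isUnit_plusPart_of_minusPart_eq hS hν hR
    have ha := isHermitian_of_isHermitian_toeplitz (by omega) hS.isHermitian
    have key := plusPart_mul_conjTranspose ha hν (extensionRow_mul_toeplitz hS)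
      (extensionRow_mul_lastBlockRow a m)
    have hS2 : (toeplitz a (m + 2)).PosDef :=
      posDef_toeplitz_succ hS (posDef_of_mul_conjTranspose_eq key hR (hr (m + 1)) hP)
    refine ⟨a, ν, hν, hS2, fun k hk => ?_⟩
    rcases Nat.le_succ_iff.1 hk with hk | rfl
    · rw [hT _ (Nat.succ_le_succ hk)]
      exact hb k hk
    · exact (cayley_succ_eq_iff hS2 hν).2 hR

end Bijection

end BlockToeplitz

theorem mainTheorem2 (p n : ℕ) (hn : 1 ≤ n) :
    (∀ (S : Matrix (Fin n × Fin p) (Fin n × Fin p) ℂ) (ν : Matrix (Fin p) (Fin p) ℂ),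
      BlockToeplitz.IsBlockToeplitz S → S.PosDef → ν.IsHermitian → ∀ k : Fin n,
        IsUnit (BlockToeplitz.diracCoeff S ν k).toBlocks₁₁ ∧
          ‖BlockToeplitz.verblunsky S ν k‖ < 1) ∧
    Set.BijOn
      (fun q : Matrix (Fin n × Fin p) (Fin n × Fin p) ℂ × Matrix (Fin p) (Fin p) ℂ =>
        BlockToeplitz.verblunsky q.1 q.2)
      (BlockToeplitz.toeplitzPairs n p)
      {ρ : Fin n → Matrix (Fin p) (Fin p) ℂ | ∀ k, ‖ρ k‖ < 1} := by
  obtain ⟨m, rfl⟩ := Nat.exists_eq_add_of_le' hn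
  have hfirst : ∀ (S : Matrix (Fin (m + 1) × Fin p) (Fin (m + 1) × Fin p) ℂ)
      (ν : Matrix (Fin p) (Fin p) ℂ), BlockToeplitz.IsBlockToeplitz S → S.PosDef →
      ν.IsHermitian → ∀ k : Fin (m + 1), IsUnit (BlockToeplitz.diracCoeff S ν k).toBlocks₁₁ ∧
        ‖BlockToeplitz.verblunsky S ν k‖ < 1 := by
    intro S ν hS hpos hν k
    obtain ⟨a, rfl⟩ := BlockToeplitz.exists_eq_toeplitz hS hpos.isHermitian
    obtain ⟨h1, h2, h3⟩ := BlockToeplitz.verblunsky_spec hpos hν k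
    exact ⟨h1, h3 ▸ BlockToeplitz.norm_doubling_lt_one h2⟩
  refine ⟨hfirst, fun q hq k => (hfirst q.1 q.2 hq.1 hq.2.1 hq.2.2 k).2, ?_, ?_⟩
  · rintro ⟨S, ν⟩ ⟨hS, hpos, hν⟩ ⟨S', μ⟩ ⟨hS', hpos', hμ⟩ h
    dsimp only at hS hpos hν hS' hpos' hμ h
    obtain ⟨a, rfl⟩ := BlockToeplitz.exists_eq_toeplitz hS hpos.isHermitian
    obtain ⟨b, rfl⟩ := BlockToeplitz.exists_eq_toeplitz hS' hpos'.isHermitian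
    obtain ⟨hab, rfl⟩ := BlockToeplitz.cayley_injective hν hμ m hpos hpos' fun k hk => by
      obtain ⟨-, h2, h3⟩ := BlockToeplitz.verblunsky_spec hpos hν ⟨k, Nat.lt_succ_of_le hk⟩
      obtain ⟨-, h2', h3'⟩ := BlockToeplitz.verblunsky_spec hpos' hμ ⟨k, Nat.lt_succ_of_le hk⟩
      refine BlockToeplitz.doubling_injOn h2 h2' ?_
      rw [← h3, ← h3', h]
    rw [BlockToeplitz.toeplitz_congr hab]
  · intro ρ hρ
    choose r hr hrρ using fun k => BlockToeplitz.exists_doubling_eq (hρ k)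
    -- The finite sequence is continued by 0, which lies in the open unit ball; the added terms are
    -- never evaluated.
    obtain ⟨a, ν, hν, hpos, ha⟩ := BlockToeplitz.exists_cayley_eq
      (r := fun k => if h : k < m + 1 then r ⟨k, h⟩ else 0) (fun k => by
        split_ifs with h
        · exact hr _
        · simp) m
    refine ⟨(BlockToeplitz.toeplitz a (m + 1), ν),
      ⟨BlockToeplitz.isBlockToeplitz_toeplitz a _, hpos, hν⟩, ?_⟩
    funext k
    dsimp only
    rw [(BlockToeplitz.verblunsky_spec hpos hν k).2.2, ha k (Nat.le_of_lt_succ k.2), dif_pos k.2]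
    exact hrρ k
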